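/- Let $N\ge 2$ and $p\ge 2$ be integers, let $a_1,\dots,a_p$ be distinct integers in $\{0,\dots,N-1\}$, and let $\mathbf C$ be the attractor of the maps $\sigma_i(x)=\frac1N(x+a_i)$, i.e. the unique nonempty compact set $\mathbf C\subset\mathbb R$ with $\mathbf C=\bigcup_{i=1}^p\sigma_i(\mathbf C)$; equivalently, $\mathbf C=\{\sum_{j\ge1}d_jN^{-j} : d_j\in\{a_1,\dots,a_p\}\}$. Put $$\mathcal R=\bigcup_{n\in\mathbb Z}\bigcup_{k\in\mathbb Z}N^{-n}(\mathbf C+k),\qquad s=\log_N p ,$$ and let $\mathcal H^s$ be the $s$-dimensional Hausdorff measure. Then $0<\mathcal H^s(\mathbf C)<\infty$. Normalize the measure on $\mathcal R$ so that $\mathbf C$ has measure $1$, i.e. let $L^2(\mathcal R,\mathcal H^s)$ denote the complex $L^2$-space of the measure $\mathcal H^s(\mathbf C)^{-1}\,\mathcal H^s|_{\mathcal R}$. On it let $T$ and $U$ be the unitary operators $Tf(x)=f(x-1)$ and $Uf(x)=p^{-1/2}f(x/N)$, and let $\varphi=\chi_{\mathbf C}$. With the low-pass filter $m_0(z)=p^{-1/2}\sum_{i=1}^pz^{a_i}$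 the scaling equation $U\varphi=m_0(T)\varphi$ holds. List the elements of $\{0,\dots,N-1\}\setminus\{a_1,\dots,a_p\}$ as $g_1,\dots,g_{N-p}$, put $\eta=e^{2\pi i/p}$, and define the high-pass filters $$m_l(z)=z^{g_l}\quad(1\le l\le N-p),\qquad m_{N-p+k}(z)=p^{-1/2}\sum_{i=1}^p\eta^{k(i-1)}z^{a_i}\quad(1\le k\le p-1),$$ and the wavelets $\psi_i=U^{-1}m_i(T)\varphi$ for $1\le i\le N-1$. Then $$\{U^mT^n\psi_i : m,n\in\mathbb Z,\ 1\le i\le N-1\}$$ is an orthonormal basis of $L^2(\mathcal R,\mathcal H^s)$. In particular, let $N=3$, $p=2$, $(a_1,a_2)=(0,2)$. Then $\mathbf C$ is the middle-third Cantor set, $\mathcal H^s(\mathbf C)=1$ for $s=\log_32$, the two wavelets are $$\psi_1(x)=\sqrt2\,\chi_{\mathbf C}(3x-1),\qquad \psi_2(x)=\chi_{\mathbf C}(3x)-\chi_{\mathbf C}(3x-2)$$ (almost everywhere), and the functions $\psi_{i,j,k}(x)=2^{j/2}\psi_i(3^jx-k)$, $i=1,2$, $j,k\in\mathbb Z$,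 form an orthonormal basis of $L^2(\mathcal R,\mathcal H^s)$, where $\mathcal H^s$ is the Hausdorff measure itself. -/

import Mathlib

open MeasureTheory Polynomial
open scoped ENNReal NNReal

noncomputable section

/-- The data of an affine iterated function system `σ_i(x) = (x + a_i) / N`, `i < p`, on the line:
an integer scale `N ≥ 2` and `p ≥ 2` distinct digits `a_i` in `{0, …, N - 1}`, listed in any
order. (`p ≥ 2` says that the dimension `log_N p` is positive.) -/
structure AffineIFS where
  N : ℕ
  p : ℕ
  two_le_N : 2 ≤ N
  two_le_p : 2 ≤ p
  digit : Fin p → Fin N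
  digit_injective : Function.Injective digit

namespace AffineIFS

variable (S : AffineIFS)

/-- The contraction `σ_i(x) = (x + a_i) / N`. -/
def sigma (i : Fin S.p) (x : ℝ) : ℝ := (x + ((S.digit i : ℕ) : ℝ)) / S.N

/-- The attractor `C`, as the set of all sums `∑_{j ≥ 1} d_j N^{-j}` with digits `d_j` among the
`a_i`. By `isAttractor_iff` it is the unique nonempty compact set with `C = ⋃ i, σ_i(C)`. -/
def attractor : Set ℝ :=
  Set.range fun d : ℕ → Fin S.p => ∑' j : ℕ, ((S.digit (d j) : ℕ) : ℝ) / (S.N : ℝ) ^ (j + 1)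

end AffineIFS

/-- The inflation `⋃_{n, k ∈ ℤ} N^{-n} (C + k)` of a set `C`. -/
def inflation (N : ℕ) (C : Set ℝ) : Set ℝ :=
  ⋃ (n : ℤ) (k : ℤ), (fun x : ℝ => (N : ℝ) ^ (-n) * (x + k)) '' C

namespace AffineIFS

variable (S : AffineIFS)

/-- The enlarged fractal `R = ⋃_{n, k ∈ ℤ} N^{-n} (C + k)`. -/
def R : Set ℝ := inflation S.N S.attractor

/-- The similarity dimension `s = log_N p`. -/
def dim : ℝ := Real.logb S.N S.p

/-- The `s`-dimensional Hausdorff measure on `R`, normalized so that `C` has measure one. -/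
def mu : Measure ℝ :=
  (Measure.hausdorffMeasure S.dim S.attractor)⁻¹ • (Measure.hausdorffMeasure S.dim).restrict S.R

/-- The complex Hilbert space `L²(R, H^s)`. -/
abbrev H : Type := Lp ℂ 2 S.mu

/-! ### Facts about the attractor -/

lemma N_pos : (0 : ℝ) < S.N := by
  have := S.two_le_N
  exact_mod_cast (by omega : 0 < S.N)

lemma one_lt_N : (1 : ℝ) < S.N := by
  have := S.two_le_N
  exact_mod_cast (by omega : 1 < S.N)

lemma p_pos : (0 : ℝ) < S.p := by
  have := S.two_le_p
  exact_mod_cast (by omega : 0 < S.p)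

lemma geom_summable : Summable fun j : ℕ => (S.N : ℝ) * ((S.N : ℝ)⁻¹ ^ (j + 1)) := by
  apply Summable.mul_left
  have h := summable_geometric_of_lt_one (inv_nonneg.2 S.N_pos.le) (inv_lt_one_of_one_lt₀ S.one_lt_N)
  exact (summable_nat_add_iff 1).2 h

lemma term_bound (i : Fin S.p) (j : ℕ) :
    ‖((S.digit i : ℕ) : ℝ) / (S.N : ℝ) ^ (j + 1)‖ ≤ (S.N : ℝ) * ((S.N : ℝ)⁻¹ ^ (j + 1)) := by
  have h0 := S.N_pos
  rw [Real.norm_of_nonneg (by positivity), div_eq_mul_inv, inv_pow]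
  gcongr
  exact_mod_cast (S.digit i).2.le

lemma term_summable (d : ℕ → Fin S.p) :
    Summable fun j : ℕ => ((S.digit (d j) : ℕ) : ℝ) / (S.N : ℝ) ^ (j + 1) :=
  Summable.of_norm_bounded S.geom_summable fun j => S.term_bound (d j) j

lemma isCompact_attractor : IsCompact S.attractor := by
  refine isCompact_range (continuous_tsum (fun j => ?_) S.geom_summable
    fun j d => S.term_bound (d j) j)
  have h : Continuous fun i : Fin S.p => ((S.digit i : ℕ) : ℝ) / (S.N : ℝ) ^ (j + 1) :=
    continuous_of_discreteTopology
  exact h.comp (continuous_apply j)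

lemma attractor_nonempty : S.attractor.Nonempty := by
  have := S.two_le_p
  exact ⟨_, ⟨fun _ => ⟨0, by omega⟩, rfl⟩⟩

lemma measurableSet_attractor : MeasurableSet S.attractor := S.isCompact_attractor.measurableSet

lemma tsum_split (d : ℕ → Fin S.p) :
    (∑' j : ℕ, ((S.digit (d j) : ℕ) : ℝ) / (S.N : ℝ) ^ (j + 1)) =
      S.sigma (d 0) (∑' j : ℕ, ((S.digit (d (j + 1)) : ℕ) : ℝ) / (S.N : ℝ) ^ (j + 1)) := by
  have h0 := S.N_pos
  rw [(S.term_summable d).tsum_eq_zero_add, sigma, add_div, add_comm, ← tsum_div_const]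
  simp only [div_div, ← pow_succ, zero_add, pow_one]

lemma attractor_eq_iUnion : S.attractor = ⋃ i, S.sigma i '' S.attractor := by
  ext x
  simp only [Set.mem_iUnion]
  constructor
  · rintro ⟨d, rfl⟩
    exact ⟨d 0, _, ⟨fun j => d (j + 1), rfl⟩, (S.tsum_split d).symm⟩
  · rintro ⟨i, _, ⟨d, rfl⟩, rfl⟩
    exact ⟨fun j => Nat.casesOn j i d,
      S.tsum_split (fun j => Nat.casesOn (motive := fun _ => Fin S.p) j i d)⟩

/-- The attractor is the unique nonempty compact set that is invariant under the system. -/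
theorem isAttractor_iff (K : Set ℝ) :
    (IsCompact K ∧ K.Nonempty ∧ K = ⋃ i, S.sigma i '' K) ↔ K = S.attractor := by
  constructor
  · rintro ⟨hK, ⟨y, hy⟩, hinv⟩
    have h0 := S.N_pos
    obtain ⟨B, hB⟩ := hK.isBounded.exists_norm_le
    have hlim : ∀ z : ℕ → ℝ, (∀ n, z n ∈ K) →
        Filter.Tendsto (fun n => z n / (S.N : ℝ) ^ n) Filter.atTop (nhds 0) := by
      intro z hz
      have hg : Filter.Tendsto (fun n : ℕ => B * (S.N : ℝ)⁻¹ ^ n) Filter.atTop (nhds 0) := by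
        simpa using (tendsto_pow_atTop_nhds_zero_of_lt_one (inv_nonneg.2 S.N_pos.le)
          (inv_lt_one_of_one_lt₀ S.one_lt_N)).const_mul B
      refine squeeze_zero_norm (fun n => ?_) hg
      rw [norm_div, div_eq_mul_inv, norm_pow, Real.norm_of_nonneg h0.le, inv_pow]
      gcongr
      exact hB _ (hz n)
    apply Set.Subset.antisymm
    · intro x hx
      have hstep : ∀ u : K, ∃ i, ∃ v : K, (u : ℝ) = S.sigma i v := by
        rintro ⟨u, hu⟩
        rw [hinv] at hu
        obtain ⟨i, v, hv, rfl⟩ := Set.mem_iUnion.1 hu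
        exact ⟨i, ⟨v, hv⟩, rfl⟩
      choose f g hfg using hstep
      let z : ℕ → K := fun n => g^[n] ⟨x, hx⟩
      have hz : ∀ n, (z n : ℝ) = S.sigma (f (z n)) (z (n + 1)) := by
        intro n
        have : z (n + 1) = g (z n) := Function.iterate_succ_apply' g n _
        rw [this]
        exact hfg _
      have hsum : ∀ n, x = (∑ j ∈ Finset.range n,
          ((S.digit (f (z j)) : ℕ) : ℝ) / (S.N : ℝ) ^ (j + 1)) + (z n : ℝ) / (S.N : ℝ) ^ n := by
        intro n
        induction n with
        | zero => simp [z]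
        | succ n ih =>
          rw [Finset.sum_range_succ, add_assoc]
          refine ih.trans ?_
          congr 1
          rw [hz n, sigma]
          field_simp
          ring
      refine ⟨fun j => f (z j), ?_⟩
      have h1 := (S.term_summable fun j => f (z j)).hasSum.tendsto_sum_nat.add
        (hlim (fun n => z n) fun n => (z n).2)
      rw [add_zero] at h1
      exact tendsto_nhds_unique h1 (tendsto_const_nhds.congr hsum)
    · rintro _ ⟨d, rfl⟩
      have hmem : ∀ n (d : ℕ → Fin S.p), (∑ j ∈ Finset.range n,
          ((S.digit (d j) : ℕ) : ℝ) / (S.N : ℝ) ^ (j + 1)) + y / (S.N : ℝ) ^ n ∈ K := by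
        intro n
        induction n with
        | zero => intro d; simpa using hy
        | succ n ih =>
          intro d
          rw [hinv]
          refine Set.mem_iUnion.2 ⟨d 0, _, ih (fun j => d (j + 1)), ?_⟩
          rw [Finset.sum_range_succ', sigma, add_div, add_div, Finset.sum_div]
          have e1 : ∀ j : ℕ, ((S.digit (d (j + 1)) : ℕ) : ℝ) / (S.N : ℝ) ^ (j + 1) / (S.N : ℝ) =
              ((S.digit (d (j + 1)) : ℕ) : ℝ) / (S.N : ℝ) ^ (j + 1 + 1) := by
            intro j; rw [pow_succ _ (j + 1), div_div]
          simp only [e1, div_div, ← pow_succ, zero_add, pow_one]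
          ring
      have h1 := (S.term_summable d).hasSum.tendsto_sum_nat.add (hlim (fun _ => y) fun _ => hy)
      rw [add_zero] at h1
      exact hK.isClosed.mem_of_tendsto h1 (Filter.Eventually.of_forall fun n => hmem n d)
  · rintro rfl
    exact ⟨S.isCompact_attractor, S.attractor_nonempty, S.attractor_eq_iUnion⟩

lemma measurableSet_R : MeasurableSet S.R := by
  refine MeasurableSet.iUnion fun n => MeasurableSet.iUnion fun k => ?_
  exact (S.isCompact_attractor.image (by fun_prop)).measurableSet

lemma mem_R {x : ℝ} : x ∈ S.R ↔ ∃ n k : ℤ, (S.N : ℝ) ^ n * x - k ∈ S.attractor := by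
  have h0 := S.N_pos
  simp only [R, inflation, Set.mem_iUnion, Set.mem_image]
  refine exists_congr fun n => exists_congr fun k => ?_
  constructor
  · rintro ⟨y, hy, rfl⟩
    rw [← mul_assoc, ← zpow_add₀ h0.ne']
    simpa using hy
  · intro h
    refine ⟨_, h, ?_⟩
    rw [sub_add_cancel, ← mul_assoc, ← zpow_add₀ h0.ne']
    simp

lemma N_mul_mem_R {x : ℝ} : (S.N : ℝ) * x ∈ S.R ↔ x ∈ S.R := by
  have h0 := S.N_pos
  simp only [mem_R]
  constructor
  · rintro ⟨n, k, h⟩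
    refine ⟨n + 1, k, ?_⟩
    rwa [zpow_add_one₀ h0.ne', mul_assoc]
  · rintro ⟨n, k, h⟩
    refine ⟨n - 1, k, ?_⟩
    rwa [← mul_assoc, ← zpow_add_one₀ h0.ne', sub_add_cancel]

lemma attractor_step {x : ℝ} (hx : x ∈ S.attractor) :
    ∃ k : ℤ, (S.N : ℝ) * x - k ∈ S.attractor := by
  rw [attractor_eq_iUnion] at hx
  obtain ⟨i, y, hy, rfl⟩ := Set.mem_iUnion.1 hx
  have h0 := S.N_pos
  refine ⟨((S.digit i : ℕ) : ℤ), ?_⟩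
  have : (S.N : ℝ) * S.sigma i y - (((S.digit i : ℕ) : ℤ) : ℝ) = y := by
    rw [sigma]; push_cast; field_simp; ring
  rwa [this]

lemma mem_R_nat {x : ℝ} :
    x ∈ S.R ↔ ∃ n : ℕ, ∃ k : ℤ, (S.N : ℝ) ^ n * x - k ∈ S.attractor := by
  rw [mem_R]
  constructor
  · rintro ⟨n, k, h⟩
    have key : ∀ m : ℕ, ∃ k : ℤ, (S.N : ℝ) ^ (n + m) * x - k ∈ S.attractor := by
      intro m
      induction m with
      | zero => exact ⟨k, by simpa using h⟩
      | succ m ih =>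
        obtain ⟨k', h'⟩ := ih
        obtain ⟨l, hl⟩ := S.attractor_step h'
        refine ⟨S.N * k' + l, ?_⟩
        have e : n + ((m + 1 : ℕ) : ℤ) = (n + m) + 1 := by push_cast; ring
        rw [e, zpow_add_one₀ S.N_pos.ne']
        push_cast
        convert hl using 1
        ring
    obtain ⟨k', h'⟩ := key (-n).toNat
    refine ⟨(n + (-n).toNat).toNat, k', ?_⟩
    have e : ((n + (-n).toNat).toNat : ℤ) = n + (-n).toNat := by omega
    rw [← zpow_natCast, e]
    exact h'
  · rintro ⟨n, k, h⟩
    exact ⟨n, k, by simpa using h⟩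

lemma add_int_mem_R {x : ℝ} (l : ℤ) (hx : x ∈ S.R) : x + l ∈ S.R := by
  obtain ⟨n, k, h⟩ := S.mem_R_nat.1 hx
  refine S.mem_R_nat.2 ⟨n, k + S.N ^ n * l, ?_⟩
  push_cast
  convert h using 1
  ring

/-! ### The translation and dilation operators -/

lemma dim_nonneg : 0 ≤ S.dim :=
  Real.logb_nonneg S.one_lt_N (by have := S.two_le_p; exact_mod_cast (by omega : 1 ≤ S.p))

end AffineIFS

/-- If `e` scales `μ` by the factor `κ`, then `f ↦ κ^{-1/2} f ∘ e` maps `L²(μ)` to itself. -/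
lemma memLp_scaledComp {μ : Measure ℝ} (e : ℝ ≃ᵐ ℝ) {κ : ℝ}
    (h : μ.map e = ENNReal.ofReal κ • μ) (f : Lp ℂ 2 μ) :
    MemLp (fun x => (((Real.sqrt κ)⁻¹ : ℝ) : ℂ) * f (e x)) 2 μ := by
  have hf : MemLp f 2 (μ.map e) := by
    rw [h]; exact (Lp.memLp f).smul_measure ENNReal.ofReal_ne_top
  exact (hf.comp_of_map e.measurable.aemeasurable).const_mul _

lemma map_symm_scaled {μ : Measure ℝ} (e : ℝ ≃ᵐ ℝ) {κ : ℝ} (hκ : 0 < κ)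
    (h : μ.map e = ENNReal.ofReal κ • μ) : μ.map e.symm = ENNReal.ofReal κ⁻¹ • μ := by
  have h1 : μ = ENNReal.ofReal κ • μ.map e.symm := by
    conv_lhs => rw [← e.map_symm_map (μ := μ), h]
    rw [Measure.map_smul]
  conv_rhs => rw [h1]
  rw [smul_smul, ← ENNReal.ofReal_mul (inv_nonneg.2 hκ.le), inv_mul_cancel₀ hκ.ne']
  simp

lemma ae_comp_scaled {μ : Measure ℝ} (e : ℝ ≃ᵐ ℝ) {κ : ℝ}
    (h : μ.map e = ENNReal.ofReal κ • μ) {P : ℝ → Prop} (hP : ∀ᵐ x ∂μ, P x) :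
    ∀ᵐ x ∂μ, P (e x) := by
  have : ∀ᵐ x ∂(μ.map e), P x := by
    rw [h]; exact Measure.ae_smul_measure hP _
  exact ae_of_ae_map e.measurable.aemeasurable this

/-- If the bijection `e` scales `μ` by the factor `κ`, then `f ↦ κ^{-1/2} f ∘ e` is a unitary
operator on `L²(μ)`. -/
def scaledComp {μ : Measure ℝ} (e : ℝ ≃ᵐ ℝ) {κ : ℝ} (hκ : 0 < κ)
    (h : μ.map e = ENNReal.ofReal κ • μ) : Lp ℂ 2 μ ≃ₗᵢ[ℂ] Lp ℂ 2 μ where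
  toFun f := (memLp_scaledComp e h f).toLp _
  invFun f := (memLp_scaledComp e.symm (map_symm_scaled e hκ h) f).toLp _
  map_add' f g := by
    rw [← MemLp.toLp_add]
    refine MemLp.toLp_congr _ _ ?_
    filter_upwards [ae_comp_scaled e h (Lp.coeFn_add f g)] with x hx
    simp only [hx, Pi.add_apply]
    exact mul_add _ _ _
  map_smul' c f := by
    rw [RingHom.id_apply, ← MemLp.toLp_const_smul]
    refine MemLp.toLp_congr _ _ ?_
    filter_upwards [ae_comp_scaled e h (Lp.coeFn_smul c f)] with x hx
    simp only [hx, Pi.smul_apply, smul_eq_mul]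
    ring
  left_inv f := by
    have h' := map_symm_scaled e hκ h
    refine Lp.ext ?_
    filter_upwards [MemLp.coeFn_toLp (memLp_scaledComp e.symm h'
      ((memLp_scaledComp e h f).toLp _)),
      ae_comp_scaled e.symm h' (MemLp.coeFn_toLp (memLp_scaledComp e h f))] with x h1 h2
    rw [h1, h2, e.apply_symm_apply, ← mul_assoc, ← Complex.ofReal_mul, Real.sqrt_inv, inv_inv,
      mul_inv_cancel₀ (Real.sqrt_pos.2 hκ).ne']
    simp
  right_inv f := by
    have h' := map_symm_scaled e hκ h
    refine Lp.ext ?_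
    filter_upwards [MemLp.coeFn_toLp (memLp_scaledComp e h
      ((memLp_scaledComp e.symm h' f).toLp _)),
      ae_comp_scaled e h (MemLp.coeFn_toLp (memLp_scaledComp e.symm h' f))] with x h1 h2
    rw [h1, h2, e.symm_apply_apply, ← mul_assoc, ← Complex.ofReal_mul, Real.sqrt_inv, inv_inv,
      inv_mul_cancel₀ (Real.sqrt_pos.2 hκ).ne']
    simp
  norm_map' f := by
    change ‖(memLp_scaledComp e h f).toLp _‖ = ‖f‖
    rw [Lp.norm_toLp, Lp.norm_def]
    congr 1
    have e1 : (fun x => (((Real.sqrt κ)⁻¹ : ℝ) : ℂ) * f (e x)) =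
        (((Real.sqrt κ)⁻¹ : ℝ) : ℂ) • (f ∘ e) := rfl
    have hm : AEStronglyMeasurable f (μ.map e) := by
      rw [h]; exact (Lp.aestronglyMeasurable f).smul_measure _
    rw [e1, eLpNorm_const_smul, ← eLpNorm_map_measure hm e.measurable.aemeasurable, h,
      eLpNorm_smul_measure_of_ne_top (by simp), smul_eq_mul, ← mul_assoc]
    have e2 : ‖(((Real.sqrt κ)⁻¹ : ℝ) : ℂ)‖ₑ * ENNReal.ofReal κ ^ (1 / (2 : ℝ≥0∞)).toReal = 1 := by
      have hs := Real.sqrt_pos.2 hκ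
      have e3 : ‖(((Real.sqrt κ)⁻¹ : ℝ) : ℂ)‖ₑ = ENNReal.ofReal (Real.sqrt κ)⁻¹ := by
        rw [← ofReal_norm, Complex.norm_real, Real.norm_of_nonneg (by positivity)]
      rw [e3, ENNReal.ofReal_rpow_of_nonneg hκ.le (by positivity),
        ← ENNReal.ofReal_mul (by positivity)]
      have : (1 / (2 : ℝ≥0∞)).toReal = 1 / 2 := by simp
      rw [this, ← Real.sqrt_eq_rpow, inv_mul_cancel₀ hs.ne', ENNReal.ofReal_one]
    rw [e2, one_mul]

lemma scaledComp_ae {μ : Measure ℝ} (e : ℝ ≃ᵐ ℝ) {κ : ℝ} (hκ : 0 < κ)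
    (h : μ.map e = ENNReal.ofReal κ • μ) (f : Lp ℂ 2 μ) :
    scaledComp e hκ h f =ᵐ[μ] fun x => (((Real.sqrt κ)⁻¹ : ℝ) : ℂ) * f (e x) :=
  MemLp.coeFn_toLp (memLp_scaledComp e h f)

namespace AffineIFS

variable (S : AffineIFS)

/-- The map `x ↦ x - 1`. -/
def shiftEquiv : ℝ ≃ᵐ ℝ := MeasurableEquiv.addRight (-1 : ℝ)

/-- The map `x ↦ x / N`. -/
def scaleEquiv : ℝ ≃ᵐ ℝ := MeasurableEquiv.mulLeft₀ ((S.N : ℝ)⁻¹) (inv_ne_zero S.N_pos.ne')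

lemma map_shift : S.mu.map shiftEquiv = ENNReal.ofReal 1 • S.mu := by
  rw [ENNReal.ofReal_one, one_smul, mu, Measure.map_smul]
  congr 1
  ext E hE
  rw [shiftEquiv.map_apply, Measure.restrict_apply (shiftEquiv.measurable hE),
    Measure.restrict_apply hE]
  have h1 : shiftEquiv ⁻¹' E ∩ S.R = (IsometryEquiv.addRight (-1 : ℝ)) ⁻¹' (E ∩ S.R) := by
    ext x
    have : x + -1 ∈ S.R ↔ x ∈ S.R :=
      ⟨fun h => by simpa using S.add_int_mem_R 1 h, fun h => by simpa using S.add_int_mem_R (-1) h⟩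
    simp [shiftEquiv, this]
  rw [h1, IsometryEquiv.hausdorffMeasure_preimage]

open scoped Pointwise in
lemma map_scale : S.mu.map S.scaleEquiv = ENNReal.ofReal S.p • S.mu := by
  have h0 := S.N_pos
  rw [mu, Measure.map_smul, smul_comm]
  congr 1
  ext E hE
  rw [S.scaleEquiv.map_apply, Measure.restrict_apply (S.scaleEquiv.measurable hE),
    Measure.smul_apply, Measure.restrict_apply hE]
  have h1 : S.scaleEquiv ⁻¹' E ∩ S.R = (S.N : ℝ) • (E ∩ S.R) := by
    ext x
    rw [Set.mem_smul_set_iff_inv_smul_mem₀ h0.ne']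
    have : (S.N : ℝ)⁻¹ * x ∈ S.R ↔ x ∈ S.R := by
      rw [← S.N_mul_mem_R, mul_inv_cancel_left₀ h0.ne']
    simp [scaleEquiv, this]
  rw [h1, Measure.hausdorffMeasure_smul₀ S.dim_nonneg h0.ne', ENNReal.smul_def, smul_eq_mul,
    smul_eq_mul]
  congr 1
  have h2 : (S.N : ℝ) ^ S.dim = S.p := Real.rpow_logb h0 S.one_lt_N.ne' S.p_pos
  rw [ENNReal.ofReal, ENNReal.coe_inj, ← NNReal.coe_inj, NNReal.coe_rpow, coe_nnnorm,
    Real.norm_of_nonneg h0.le, h2, Real.coe_toNNReal _ S.p_pos.le]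

/-- The translation operator `(T f)(x) = f(x - 1)` on `L²(R, H^s)`. -/
def T : S.H ≃ₗᵢ[ℂ] S.H := scaledComp shiftEquiv one_pos S.map_shift

/-- The dilation operator `(U f)(x) = p^{-1/2} f(x / N)` on `L²(R, H^s)`. -/
def U : S.H ≃ₗᵢ[ℂ] S.H := scaledComp S.scaleEquiv S.p_pos S.map_scale

lemma T_ae (f : S.H) : S.T f =ᵐ[S.mu] fun x => f (x - 1) := by
  filter_upwards [scaledComp_ae shiftEquiv one_pos S.map_shift f] with x hx
  rw [T, hx]
  simp [shiftEquiv, sub_eq_add_neg]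

lemma U_ae (f : S.H) :
    S.U f =ᵐ[S.mu] fun x => (((Real.sqrt S.p)⁻¹ : ℝ) : ℂ) * f (x / S.N) := by
  filter_upwards [scaledComp_ae S.scaleEquiv S.p_pos S.map_scale f] with x hx
  rw [U, hx]
  simp [scaleEquiv, div_eq_inv_mul]

lemma mu_attractor_ne_top : S.mu S.attractor ≠ ∞ := by
  have h : S.mu S.attractor ≤ 1 := by
    rw [mu, Measure.smul_apply, smul_eq_mul]
    refine le_trans ?_ (ENNReal.inv_mul_le_one (Measure.hausdorffMeasure S.dim S.attractor))
    gcongr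
    exact Measure.restrict_le_self
  exact (h.trans_lt ENNReal.one_lt_top).ne

/-- The scaling function `φ = χ_C`, as an element of `L²(R, H^s)`. -/
def phi : S.H := indicatorConstLp 2 S.measurableSet_attractor S.mu_attractor_ne_top (1 : ℂ)

/-! ### Filters and wavelets -/

/-- The filter `p^{-1/2} ∑_{i = 1}^{p} η^{k (i - 1)} z^{a_i}` with `η = exp (2πi / p)`, as a
polynomial in `z`; the indices of the digits run from `0` to `p - 1` here. -/
def dftFilter (k : ℕ) : ℂ[X] :=
  ∑ i : Fin S.p, C ((((Real.sqrt S.p)⁻¹ : ℝ) : ℂ) *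
    Complex.exp (2 * Real.pi * Complex.I / S.p) ^ (k * (i : ℕ))) * X ^ (S.digit i : ℕ)

/-- The low-pass filter `m₀ = p^{-1/2} ∑_i z^{a_i}`. -/
def lowPass : ℂ[X] :=
  ∑ i : Fin S.p, C (((Real.sqrt S.p)⁻¹ : ℝ) : ℂ) * X ^ (S.digit i : ℕ)

/-- The labels of the `N - 1` wavelets: one for each of the `N - p` missing digits, and one for
each `k ∈ {1, …, p - 1}`, where `j : Fin (p - 1)` stands for `k = j + 1`. -/
abbrev WaveletIndex : Type := {d : Fin S.N // d ∉ Set.range S.digit} ⊕ Fin (S.p - 1)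

/-- The high-pass filters: `z^d` for a missing digit `d` (gap-filling), and
`p^{-1/2} ∑_i η^{k (i - 1)} z^{a_i}` for `1 ≤ k ≤ p - 1` (detail-filling). -/
def highPass : S.WaveletIndex → ℂ[X]
  | Sum.inl d => X ^ ((d : Fin S.N) : ℕ)
  | Sum.inr j => S.dftFilter ((j : ℕ) + 1)

/-- The operator `m(T)` for a polynomial `m`. -/
def filterOp (m : ℂ[X]) : Module.End ℂ S.H :=
  aeval (S.T.toLinearEquiv.toLinearMap : Module.End ℂ S.H) m

/-- The wavelets `ψ_i = U⁻¹ m_i(T) φ`. -/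
def psi (i : S.WaveletIndex) : S.H := S.U.symm (S.filterOp (S.highPass i) S.phi)

/-- The system with `N = 3` and digits `0, 2`. -/
def cantor : AffineIFS where
  N := 3
  p := 2
  two_le_N := by norm_num
  two_le_p := le_rfl
  digit := ![0, 2]
  digit_injective := by decide

/-- The only missing digit of the Cantor system is `1`. -/
lemma cantor_gap : (1 : Fin 3) ∉ Set.range cantor.digit := by
  change (1 : Fin 3) ∉ Set.range ![0, 2]
  simp

end AffineIFS

/-- The indicator function of the middle-third Cantor set. -/
def cantorIndicator : ℝ → ℂ := cantorSet.indicator fun _ => 1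

/-- The functions `ψ₁(x) = √2 χ_C(3x - 1)` and `ψ₂(x) = χ_C(3x) - χ_C(3x - 2)`. -/
def cantorWavelet : Fin 2 → ℝ → ℂ :=
  ![fun x => ((Real.sqrt 2 : ℝ) : ℂ) * cantorIndicator (3 * x - 1),
    fun x => cantorIndicator (3 * x) - cantorIndicator (3 * x - 2)]

end

/-! Positivity and finiteness of the Hausdorff measure come from two estimates at scale `N^{-n}`.
The `p^n` cylinders of order `n` cover `C`, have diameter at most `N^{-n}`, and `(N^{-n})^s =
p^{-n}`, so `H^s(C) ≤ 1`. Conversely, the image of the uniform Bernoulli measure gives an `N`-adic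
interval of order `n` mass at most `p^{-n}`, and the mass distribution principle yields a positive
lower bound. For the Cantor set the sharp bound "mass of `[a, b]` at most `(b - a)^s`" holds, by
concavity of `x ↦ x^s` and `3^s = 2`, and the measure is exactly one.

For the basis, the translates `T^k φ` are orthonormal, because distinct integer translates of `C`
share at most one point and points are null. Write `k = N n + d` with `0 ≤ d < N`. Since `U T^n =
T^{N n} U`, applying `U` to `T^n φ` and to the `T^n ψ_i` produces, for each `n`, the vectors `T^{N n
+ g} φ` with `g` a missing digit, together with the discrete Fourier transform (`dftVec`) of the
vectors `T^{N n + a_i} φ`. The Fourier matrix is unitary, so this is another orthonormal system with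
the span of the `T^k φ`. Hence wavelets on one level are orthonormal and orthogonal to all `T^k φ`,
and as `U` preserves the span of the `T^k φ`, different levels are orthogonal
(`orthonormal_wavelet`).

For completeness, let `f` be orthogonal to all wavelets. Inverting the Fourier matrix shows that the
coefficient of `f` at `U^m T^k φ` is zero or `p^{-1/2}` times, in absolute value, a coefficient at
level `m + 1`. Iterating, it is at most `p^{-r/2} ‖f‖` for every `r`, so it vanishes
(`eq_zero_of_forall_wavelet`). These coefficients are multiples of the integrals of `f` over the
copies of `C`, and arbitrarily fine copies determine `f` (`eq_zero_of_setIntegral_piece_eq_zero`).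
-/

noncomputable section

/-! ### The coding map -/

namespace AffineIFS

variable (S : AffineIFS)

/-- The coding map from digit sequences to the attractor. -/
def code (d : ℕ → Fin S.p) : ℝ :=
  ∑' j : ℕ, ((S.digit (d j) : ℕ) : ℝ) / (S.N : ℝ) ^ (j + 1)

lemma continuous_code : Continuous S.code := by
  refine continuous_tsum (fun j => ?_) S.geom_summable fun j d => S.term_bound (d j) j
  have h : Continuous fun i : Fin S.p => ((S.digit i : ℕ) : ℝ) / (S.N : ℝ) ^ (j + 1) :=
    continuous_of_discreteTopology
  exact h.comp (continuous_apply j)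

lemma code_mem (d : ℕ → Fin S.p) : S.code d ∈ S.attractor := ⟨d, rfl⟩

lemma code_cons (i : Fin S.p) (d : ℕ → Fin S.p) :
    S.code (fun j => Nat.casesOn j i d) = S.sigma i (S.code d) :=
  S.tsum_split (fun j => Nat.casesOn (motive := fun _ => Fin S.p) j i d)

/-- The expansion with the largest digit `N - 1` in every place; it bounds the attractor by one. -/
lemma hasSum_geom : HasSum (fun j : ℕ => ((S.N : ℝ) - 1) / (S.N : ℝ) ^ (j + 1)) 1 := by
  have h0 := S.N_pos
  have h1 := S.one_lt_N
  have h := (hasSum_geometric_of_lt_one (inv_nonneg.2 h0.le) (inv_lt_one_of_one_lt₀ h1)).mul_left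
    (((S.N : ℝ) - 1) / S.N)
  have e1 : ((S.N : ℝ) - 1) / S.N * (1 - (S.N : ℝ)⁻¹)⁻¹ = 1 := by
    have : (S.N : ℝ) - 1 ≠ 0 := by linarith
    field_simp
  rw [e1] at h
  have e2 : (fun j : ℕ => ((S.N : ℝ) - 1) / (S.N : ℝ) ^ (j + 1)) =
      fun j : ℕ => ((S.N : ℝ) - 1) / S.N * (S.N : ℝ)⁻¹ ^ j := by
    funext j
    rw [pow_succ, inv_pow]
    field_simp
  rwa [e2]

lemma attractor_subset_Icc : S.attractor ⊆ Set.Icc 0 1 := by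
  have h0 := S.N_pos
  rintro _ ⟨d, rfl⟩
  refine ⟨tsum_nonneg fun j => by positivity, ?_⟩
  rw [← S.hasSum_geom.tsum_eq]
  refine (S.term_summable d).tsum_le_tsum (fun j => ?_) S.hasSum_geom.summable
  gcongr
  have := (S.digit (d j)).2
  have : ((S.digit (d j) : ℕ) : ℝ) + 1 ≤ S.N := by exact_mod_cast this
  linarith

lemma code_eq_add (d : ℕ → Fin S.p) (n : ℕ) :
    S.code d = (∑ j ∈ Finset.range n, ((S.digit (d j) : ℕ) : ℝ) / (S.N : ℝ) ^ (j + 1)) +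
      S.code (fun j => d (j + n)) / (S.N : ℝ) ^ n := by
  rw [code, ← (S.term_summable d).sum_add_tsum_nat_add n, code, ← tsum_div_const]
  congr 1
  refine tsum_congr fun j => ?_
  rw [div_div, ← pow_add]
  congr 2
  ring

/-! ### The upper bound for the Hausdorff measure -/

lemma dim_pos : 0 < S.dim :=
  Real.logb_pos S.one_lt_N (by have := S.two_le_p; exact_mod_cast (by omega : 1 < S.p))

lemma N_rpow_dim : (S.N : ℝ) ^ S.dim = S.p := Real.rpow_logb S.N_pos S.one_lt_N.ne' S.p_pos

lemma inv_N_pow_rpow_dim (n : ℕ) : ((S.N : ℝ)⁻¹ ^ n) ^ S.dim = (S.p : ℝ)⁻¹ ^ n := by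
  rw [← Real.rpow_natCast, ← Real.rpow_mul (inv_nonneg.2 S.N_pos.le), mul_comm, Real.rpow_mul
    (inv_nonneg.2 S.N_pos.le), Real.inv_rpow S.N_pos.le, N_rpow_dim, Real.rpow_natCast]

/-- The part of the attractor coded by the sequences that start with a given word. -/
def cylinder (n : ℕ) (w : Fin n → Fin S.p) : Set ℝ := S.code '' {d | ∀ j : Fin n, d j = w j}

lemma ediam_cylinder_le (n : ℕ) (w : Fin n → Fin S.p) :
    Metric.ediam (S.cylinder n w) ≤ ENNReal.ofReal ((S.N : ℝ)⁻¹ ^ n) := by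
  refine Metric.ediam_le ?_
  rintro _ ⟨d, hd, rfl⟩ _ ⟨e, he, rfl⟩
  rw [edist_dist]
  refine ENNReal.ofReal_le_ofReal ?_
  have h0 := S.N_pos
  rw [S.code_eq_add d n, S.code_eq_add e n]
  have : ∑ j ∈ Finset.range n, ((S.digit (d j) : ℕ) : ℝ) / (S.N : ℝ) ^ (j + 1) =
      ∑ j ∈ Finset.range n, ((S.digit (e j) : ℕ) : ℝ) / (S.N : ℝ) ^ (j + 1) := by
    refine Finset.sum_congr rfl fun j hj => ?_
    have hj := Finset.mem_range.1 hj
    rw [show d j = e j from (hd ⟨j, hj⟩).trans (he ⟨j, hj⟩).symm]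
  rw [this, dist_add_left, Real.dist_eq, ← sub_div, abs_div, abs_of_pos (pow_pos h0 n), inv_pow,
    div_eq_mul_inv]
  refine mul_le_of_le_one_left (by positivity) ?_
  have h1 := S.attractor_subset_Icc (S.code_mem fun j => d (j + n))
  have h2 := S.attractor_subset_Icc (S.code_mem fun j => e (j + n))
  rw [abs_le]
  constructor <;> linarith [h1.1, h1.2, h2.1, h2.2]

/-- Covering by the `p^n` cylinders of order `n` costs at most `p^n · (N^{-n})^s = 1`. -/
lemma hausdorffMeasure_attractor_le_one : Measure.hausdorffMeasure S.dim S.attractor ≤ 1 := by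
  have h0 := S.N_pos
  have hr : Filter.Tendsto (fun n : ℕ => ENNReal.ofReal ((S.N : ℝ)⁻¹ ^ n)) Filter.atTop (nhds 0) := by
    rw [← ENNReal.ofReal_zero]
    exact (ENNReal.continuous_ofReal.tendsto 0).comp (tendsto_pow_atTop_nhds_zero_of_lt_one
      (inv_nonneg.2 h0.le) (inv_lt_one_of_one_lt₀ S.one_lt_N))
  refine (Measure.hausdorffMeasure_le_liminf_sum S.dim S.attractor _ hr S.cylinder
    (.of_forall fun n w => S.ediam_cylinder_le n w) (.of_forall fun n => ?_)).trans ?_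
  · rintro _ ⟨d, rfl⟩
    exact Set.mem_iUnion.2 ⟨fun j => d j, d, fun _ => rfl, rfl⟩
  · refine (Filter.liminf_le_liminf (v := fun _ => 1) (.of_forall fun n => ?_)).trans (by simp)
    calc ∑ w, Metric.ediam (S.cylinder n w) ^ S.dim
        ≤ ∑ w : Fin n → Fin S.p, ENNReal.ofReal ((S.N : ℝ)⁻¹ ^ n) ^ S.dim := by
          gcongr with w
          · exact S.dim_nonneg
          · exact S.ediam_cylinder_le n w
      _ = 1 := by
          rw [ENNReal.ofReal_rpow_of_nonneg (by positivity) S.dim_nonneg, inv_N_pow_rpow_dim,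
            Finset.sum_const, Finset.card_univ, Fintype.card_fun, Fintype.card_fin,
            Fintype.card_fin, nsmul_eq_mul, ENNReal.ofReal_pow (inv_nonneg.2 S.p_pos.le),
            ENNReal.ofReal_inv_of_pos S.p_pos, ENNReal.ofReal_natCast, Nat.cast_pow, ← mul_pow,
            ENNReal.mul_inv_cancel, one_pow]
          · have := S.two_le_p
            exact_mod_cast (by omega : S.p ≠ 0)
          · simp

/-! ### The self-similar measure -/

/-- The uniform probability measure on the digits. -/
def digitMeasure : Measure (Fin S.p) := (S.p : ℝ≥0∞)⁻¹ • Measure.count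

lemma p_ne_zero : (S.p : ℝ≥0∞) ≠ 0 := by
  have := S.two_le_p
  exact_mod_cast (by omega : S.p ≠ 0)

instance : IsProbabilityMeasure S.digitMeasure := ⟨by
  rw [digitMeasure, Measure.smul_apply, Measure.count_apply MeasurableSet.univ]
  simpa using ENNReal.inv_mul_cancel S.p_ne_zero (by simp)⟩

lemma digitMeasure_eq_sum : S.digitMeasure = (S.p : ℝ≥0∞)⁻¹ • ∑ i, Measure.dirac i := by
  rw [digitMeasure, Measure.count, Measure.sum_fintype]

/-- The uniform Bernoulli measure on digit sequences. -/
def bernoulli : Measure (ℕ → Fin S.p) := Measure.infinitePi fun _ => S.digitMeasure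

instance : IsProbabilityMeasure S.bernoulli := by
  unfold bernoulli; infer_instance

lemma measurable_cons (i : Fin S.p) :
    Measurable fun (d : ℕ → Fin S.p) (j : ℕ) => (Nat.casesOn j i d : Fin S.p) := by
  refine measurable_pi_lambda _ fun j => ?_
  cases j with
  | zero => exact measurable_const
  | succ j => exact measurable_pi_apply j

/-- The first digit is uniform and independent of the rest. By uniqueness of the product measure it
suffices to compare boxes. -/
lemma bernoulli_eq : S.bernoulli = (S.p : ℝ≥0∞)⁻¹ • ∑ i : Fin S.p,
    S.bernoulli.map fun (d : ℕ → Fin S.p) (j : ℕ) => (Nat.casesOn j i d : Fin S.p) := by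
  symm
  refine Measure.eq_infinitePi _ fun s t ht => ?_
  classical
  obtain ⟨n, hn⟩ : ∃ n, s ⊆ Finset.range (n + 1) :=
    ⟨s.sup id, fun j hj => Finset.mem_range.2 (Nat.lt_succ_of_le (Finset.le_sup (f := id) hj))⟩
  -- Pad the box with full factors to an initial segment of coordinates, so that coordinate `0` can
  -- be split off.
  let t' : ℕ → Set (Fin S.p) := fun j => if j ∈ s then t j else Set.univ
  have ht' : ∀ j, MeasurableSet (t' j) := fun j => MeasurableSet.of_discrete
  have e1 : Set.pi (s : Set ℕ) t = Set.pi (Finset.range (n + 1) : Set ℕ) t' := by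
    ext d
    simp only [Set.mem_pi, Finset.mem_coe, t']
    constructor
    · intro h j _
      split_ifs with hj
      · exact h j hj
      · trivial
    · intro h j hj
      simpa [hj] using h j (hn hj)
  have e2 : ∏ j ∈ s, S.digitMeasure (t j) = ∏ j ∈ Finset.range (n + 1), S.digitMeasure (t' j) := by
    rw [← Finset.prod_subset hn]
    · refine Finset.prod_congr rfl fun j hj => ?_
      simp [t', hj]
    · intro j _ hj
      simp [t', hj]
  rw [e1, e2, Finset.prod_range_succ', Measure.smul_apply, Measure.finsetSum_apply]
  have hm : MeasurableSet (Set.pi (Finset.range (n + 1) : Set ℕ) t') :=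
    MeasurableSet.pi (Finset.countable_toSet _) fun j _ => ht' j
  have e3 : ∀ i : Fin S.p, (S.bernoulli.map fun (d : ℕ → Fin S.p) (j : ℕ) =>
      (Nat.casesOn j i d : Fin S.p)) (Set.pi (Finset.range (n + 1) : Set ℕ) t') =
      (∏ j ∈ Finset.range n, S.digitMeasure (t' (j + 1))) * Measure.dirac i (t' 0) := by
    intro i
    rw [Measure.map_apply (S.measurable_cons i) hm, Measure.dirac_apply' _ (ht' 0)]
    by_cases hi : i ∈ t' 0
    · rw [Set.indicator_of_mem hi, Pi.one_apply, mul_one]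
      rw [← Measure.infinitePi_pi (fun _ : ℕ => S.digitMeasure) (s := Finset.range n)
        (t := fun j => t' (j + 1)) (fun j _ => ht' _), ← bernoulli]
      congr 1
      ext d
      simp only [Set.mem_preimage, Set.mem_pi, Finset.mem_coe, Finset.mem_range]
      constructor
      · intro h j hj
        exact h (j + 1) (by omega)
      · intro h j hj
        cases j with
        | zero => exact hi
        | succ j => exact h j (by omega)
    · rw [Set.indicator_of_notMem hi, mul_zero]
      convert measure_empty (μ := S.bernoulli)
      ext d
      simp only [Set.mem_preimage, Set.mem_pi, Finset.mem_coe, Finset.mem_range,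
        Set.mem_empty_iff_false, iff_false]
      intro h
      exact hi (h 0 (by omega))
  simp only [e3]
  rw [← Finset.mul_sum, smul_eq_mul, mul_left_comm]
  congr 1
  rw [digitMeasure_eq_sum, Measure.smul_apply, Measure.finsetSum_apply, smul_eq_mul]

/-- The self-similar probability measure on the attractor. -/
def selfSimilar : Measure ℝ := S.bernoulli.map S.code

instance : IsProbabilityMeasure S.selfSimilar :=
  Measure.isProbabilityMeasure_map S.continuous_code.measurable.aemeasurable

lemma selfSimilar_attractor : S.selfSimilar S.attractor = 1 := by
  rw [selfSimilar, Measure.map_apply S.continuous_code.measurable S.measurableSet_attractor]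
  convert measure_univ (μ := S.bernoulli)
  exact Set.eq_univ_of_forall fun d => S.code_mem d

lemma selfSimilar_eq_zero {E : Set ℝ} (hE : Disjoint E S.attractor) : S.selfSimilar E = 0 := by
  have h : S.selfSimilar S.attractorᶜ = 0 :=
    (prob_compl_eq_zero_iff S.measurableSet_attractor).2 S.selfSimilar_attractor
  exact measure_mono_null hE.subset_compl_right h

/-- Self-similarity of the measure: split according to the first digit. All later mass estimates are
inductions on this identity. -/
lemma selfSimilar_apply {E : Set ℝ} (hE : MeasurableSet E) :
    S.selfSimilar E = (S.p : ℝ≥0∞)⁻¹ * ∑ i, S.selfSimilar (S.sigma i ⁻¹' E) := by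
  have hs : ∀ i, Measurable (S.sigma i) := fun i => by unfold sigma; fun_prop
  have hc := S.continuous_code.measurable
  rw [selfSimilar, Measure.map_apply hc hE]
  conv_lhs => rw [bernoulli_eq]
  rw [Measure.smul_apply, Measure.finsetSum_apply, smul_eq_mul]
  congr 1
  refine Finset.sum_congr rfl fun i _ => ?_
  rw [Measure.map_apply (S.measurable_cons i) (hc hE), Measure.map_apply hc (hs i hE)]
  congr 1
  ext d
  exact iff_of_eq (congrArg (· ∈ E) (S.code_cons i d))

/-! ### Mass distribution and the lower bound for the Hausdorff measure -/

lemma sigma_preimage_Ico (i : Fin S.p) (a b : ℝ) :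
    S.sigma i ⁻¹' Set.Ico a b =
      Set.Ico (S.N * a - (S.digit i : ℕ)) (S.N * b - (S.digit i : ℕ)) := by
  have h0 := S.N_pos
  ext x
  simp only [Set.mem_preimage, Set.mem_Ico, sigma, le_div_iff₀ h0, div_lt_iff₀ h0]
  constructor <;> rintro ⟨h1, h2⟩ <;> constructor <;> linarith

/-- The point `1` is in `[0, 1]` but not in `[0, 1)`, so it must be null for half-open intervals to
be usable. Its preimage under `σ_i` is `{N - a_i}`, which is disjoint from the attractor unless `a_i
= N - 1`, when it is again `{1}`. Thus `p` times the mass of `{1}` is at most that mass, which is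
finite. -/
lemma selfSimilar_one : S.selfSimilar {1} = 0 := by
  have h0 := S.N_pos
  have hp : (2 : ℝ≥0∞) ≤ S.p := by exact_mod_cast S.two_le_p
  have h1 : ∑ i, S.selfSimilar (S.sigma i ⁻¹' {1}) ≤ S.selfSimilar {1} := by
    have key : ∀ i, S.sigma i ⁻¹' {1} = {(S.N : ℝ) - (S.digit i : ℕ)} := by
      intro i
      ext x
      simp only [Set.mem_preimage, Set.mem_singleton_iff, sigma, div_eq_iff h0.ne']
      constructor <;> intro h <;> linarith
    have hz : ∀ i, (S.digit i : ℕ) + 1 ≠ S.N → S.selfSimilar (S.sigma i ⁻¹' {1}) = 0 := by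
      intro i hi
      refine S.selfSimilar_eq_zero (Set.disjoint_left.2 fun x hx hx' => ?_)
      rw [key, Set.mem_singleton_iff] at hx
      have h2 := (S.attractor_subset_Icc hx').2
      have h3 := (S.digit i).2
      have : ((S.digit i : ℕ) : ℝ) + 2 ≤ S.N := by exact_mod_cast (by omega)
      linarith
    by_cases h : ∃ i, (S.digit i : ℕ) + 1 = S.N
    · obtain ⟨i, hi⟩ := h
      rw [Finset.sum_eq_single i]
      · have hi' : ((S.digit i : ℕ) : ℝ) + 1 = S.N := by exact_mod_cast hi
        rw [key, show (S.N : ℝ) - (S.digit i : ℕ) = 1 by linarith]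
      · intro j _ hj
        refine hz j fun hj' => hj (S.digit_injective (Fin.ext ?_))
        omega
      · simp
    · push Not at h
      rw [Finset.sum_eq_zero fun i _ => hz i (h i)]
      exact zero_le
  have h2 := S.selfSimilar_apply (measurableSet_singleton (1 : ℝ))
  have h3 : (2 : ℝ≥0∞) * S.selfSimilar {1} ≤ S.selfSimilar {1} := by
    calc (2 : ℝ≥0∞) * S.selfSimilar {1} ≤ S.p * S.selfSimilar {1} := by gcongr
      _ = ∑ i, S.selfSimilar (S.sigma i ⁻¹' {1}) := by
          rw [h2, ENNReal.mul_inv_cancel_left S.p_ne_zero (by simp)]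
      _ ≤ _ := h1
  by_contra hne
  have h4 : S.selfSimilar {1} ≠ ∞ := measure_ne_top _ _
  rw [two_mul] at h3
  exact absurd h3 (not_le.2 (ENNReal.lt_add_right h4 hne))

lemma selfSimilar_Ico_eq_zero {a b : ℝ} (h : b ≤ 0 ∨ 1 ≤ a) : S.selfSimilar (Set.Ico a b) = 0 := by
  refine measure_mono_null (t := (Set.Ico a b \ {1}) ∪ {1}) (fun x hx => ?_)
    (measure_union_null (S.selfSimilar_eq_zero (Set.disjoint_left.2 fun x hx hx' => ?_))
      S.selfSimilar_one)
  · by_cases h1 : x = 1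
    · exact Or.inr h1
    · exact Or.inl ⟨hx, h1⟩
  · have h1 := S.attractor_subset_Icc hx'
    rcases h with h | h
    · linarith [hx.1.2, h1.1]
    · exact hx.2 (le_antisymm h1.2 (h.trans hx.1.1))

/-- An `N`-adic interval of order `n + 1` pulls back under each `σ_i` to one of order `n`, and at
most one of these lies in `[0, 1)`. So each order contributes one factor `p⁻¹`. -/
lemma selfSimilar_Ico_le (n : ℕ) (k : ℤ) :
    S.selfSimilar (Set.Ico ((k : ℝ) / (S.N : ℝ) ^ n) (((k : ℝ) + 1) / (S.N : ℝ) ^ n)) ≤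
      (S.p : ℝ≥0∞)⁻¹ ^ n := by
  have h0 := S.N_pos
  induction n generalizing k with
  | zero => simpa using prob_le_one
  | succ n ih =>
    rw [S.selfSimilar_apply measurableSet_Ico, pow_succ' (S.p : ℝ≥0∞)⁻¹]
    refine mul_le_mul' (le_refl (S.p : ℝ≥0∞)⁻¹) ?_
    have e : ∀ i, S.sigma i ⁻¹' Set.Ico ((k : ℝ) / (S.N : ℝ) ^ (n + 1))
        (((k : ℝ) + 1) / (S.N : ℝ) ^ (n + 1)) =
        Set.Ico (((k - (S.digit i : ℕ) * S.N ^ n : ℤ) : ℝ) / (S.N : ℝ) ^ n)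
          ((((k - (S.digit i : ℕ) * S.N ^ n : ℤ) : ℝ) + 1) / (S.N : ℝ) ^ n) := by
      intro i
      rw [sigma_preimage_Ico]
      push_cast
      congr 1 <;> · field_simp; try ring
    -- The leading base-`N` digit of the interval is the integer quotient `k / N^n`; every other
    -- digit moves the interval out of `[0, 1)`.
    have hz : ∀ i, ((S.digit i : ℕ) : ℤ) ≠ k / (S.N : ℤ) ^ n →
        S.selfSimilar (S.sigma i ⁻¹' Set.Ico ((k : ℝ) / (S.N : ℝ) ^ (n + 1))
          (((k : ℝ) + 1) / (S.N : ℝ) ^ (n + 1))) = 0 := by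
      intro i hi
      have hN : (0 : ℤ) < (S.N : ℤ) ^ n := by
        have := S.two_le_N
        positivity
      have hNR : (0 : ℝ) < (S.N : ℝ) ^ n := by positivity
      rw [e]
      refine S.selfSimilar_Ico_eq_zero ?_
      rw [div_le_iff₀ hNR, le_div_iff₀ hNR, zero_mul, one_mul]
      by_contra hcon
      push Not at hcon
      obtain ⟨h1, h2⟩ := hcon
      have h1' : 0 ≤ k - (S.digit i : ℕ) * (S.N : ℤ) ^ n := by
        have : (0 : ℤ) < k - (S.digit i : ℕ) * (S.N : ℤ) ^ n + 1 := by exact_mod_cast h1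
        omega
      have h2' : k - (S.digit i : ℕ) * (S.N : ℤ) ^ n < (S.N : ℤ) ^ n := by exact_mod_cast h2
      refine hi (le_antisymm ((Int.le_ediv_iff_mul_le hN).2 (by linarith)) ?_)
      exact Int.lt_add_one_iff.1 ((Int.ediv_lt_iff_lt_mul hN).2 (by linarith))
    by_cases h : ∃ i, ((S.digit i : ℕ) : ℤ) = k / (S.N : ℤ) ^ n
    · obtain ⟨i, hi⟩ := h
      rw [Finset.sum_eq_single i]
      · rw [e]
        exact ih _
      · intro j _ hj
        refine hz j fun hj' => hj (S.digit_injective (Fin.ext ?_))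
        exact_mod_cast hj'.trans hi.symm
      · simp
    · push Not at h
      rw [Finset.sum_eq_zero fun i _ => hz i (h i)]
      exact zero_le

lemma selfSimilar_le_of_ediam_le {n : ℕ} {E : Set ℝ}
    (hE : Metric.ediam E ≤ ENNReal.ofReal ((S.N : ℝ)⁻¹ ^ n)) :
    S.selfSimilar E ≤ 3 * (S.p : ℝ≥0∞)⁻¹ ^ n := by
  have h0 := S.N_pos
  rcases E.eq_empty_or_nonempty with rfl | ⟨x, hx⟩
  · simp
  have hNR : (0 : ℝ) < (S.N : ℝ) ^ n := by positivity
  let k : ℤ := ⌊x * (S.N : ℝ) ^ n⌋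
  let I : ℤ → Set ℝ := fun k =>
    Set.Ico ((k : ℝ) / (S.N : ℝ) ^ n) (((k : ℝ) + 1) / (S.N : ℝ) ^ n)
  -- A set of diameter at most `N^{-n}` lies in the interval containing one of its points and the
  -- two neighbours of that interval.
  have hsub : E ⊆ I (k - 1) ∪ I k ∪ I (k + 1) := by
    intro y hy
    have hd : |y - x| ≤ (S.N : ℝ)⁻¹ ^ n := by
      have := (Metric.edist_le_ediam_of_mem hy hx).trans hE
      rwa [edist_dist, ENNReal.ofReal_le_ofReal_iff (by positivity), Real.dist_eq] at this
    rw [inv_pow, ← mul_le_mul_iff_left₀ hNR, inv_mul_cancel₀ hNR.ne'] at hd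
    rw [← abs_of_pos hNR, ← abs_mul, abs_le] at hd
    have h1 : (k : ℝ) ≤ x * (S.N : ℝ) ^ n := Int.floor_le _
    have h2 : x * (S.N : ℝ) ^ n < k + 1 := Int.lt_floor_add_one _
    simp only [I, Set.mem_union, Set.mem_Ico, div_le_iff₀ hNR, lt_div_iff₀ hNR]
    push_cast
    rcases lt_or_ge (y * (S.N : ℝ) ^ n) k with h | h
    · exact Or.inl (Or.inl ⟨by linarith [hd.1], by linarith⟩)
    · rcases lt_or_ge (y * (S.N : ℝ) ^ n) (k + 1) with h' | h'
      · exact Or.inl (Or.inr ⟨h, h'⟩)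
      · exact Or.inr ⟨h', by linarith [hd.2]⟩
  calc S.selfSimilar E ≤ S.selfSimilar (I (k - 1)) + S.selfSimilar (I k) + S.selfSimilar (I (k + 1)) :=
        (measure_mono hsub).trans ((measure_union_le _ _).trans
          (add_le_add_left (measure_union_le _ _) _))
    _ ≤ (S.p : ℝ≥0∞)⁻¹ ^ n + (S.p : ℝ≥0∞)⁻¹ ^ n + (S.p : ℝ≥0∞)⁻¹ ^ n :=
        add_le_add (add_le_add (S.selfSimilar_Ico_le n _) (S.selfSimilar_Ico_le n _))
          (S.selfSimilar_Ico_le n _)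
    _ = 3 * (S.p : ℝ≥0∞)⁻¹ ^ n := by ring

lemma inv_p_pow (n : ℕ) : (S.p : ℝ≥0∞)⁻¹ ^ n = ENNReal.ofReal ((S.N : ℝ)⁻¹ ^ n) ^ S.dim := by
  have h0 := S.N_pos
  rw [ENNReal.ofReal_rpow_of_nonneg (by positivity) S.dim_nonneg, inv_N_pow_rpow_dim,
    ENNReal.ofReal_pow (inv_nonneg.2 S.p_pos.le), ENNReal.ofReal_inv_of_pos S.p_pos,
    ENNReal.ofReal_natCast]

lemma selfSimilar_le_ediam {E : Set ℝ} (hE : Metric.ediam E ≤ 1) :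
    S.selfSimilar E ≤ 3 * S.p * Metric.ediam E ^ S.dim := by
  have h0 := S.N_pos
  have hdn : Metric.ediam E ≠ ∞ := (hE.trans_lt ENNReal.one_lt_top).ne
  rcases eq_or_ne (Metric.ediam E) 0 with hd | hd
  -- A set of diameter zero has no matching scale; it is null by letting `n` grow.
  · have key : ∀ n : ℕ, S.selfSimilar E ≤ 3 * (S.p : ℝ≥0∞)⁻¹ ^ n := fun n =>
      S.selfSimilar_le_of_ediam_le (hd ▸ zero_le)
    have hlim : Filter.Tendsto (fun n : ℕ => 3 * (S.p : ℝ≥0∞)⁻¹ ^ n) Filter.atTop (nhds 0) := by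
      have hp : (S.p : ℝ≥0∞)⁻¹ < 1 := by
        rw [ENNReal.inv_lt_one]
        have := S.two_le_p
        exact_mod_cast (by omega : 1 < S.p)
      simpa using ENNReal.Tendsto.const_mul (ENNReal.tendsto_pow_atTop_nhds_zero_of_lt_one hp)
        (Or.inr (by simp : (3 : ℝ≥0∞) ≠ ∞))
    exact (ge_of_tendsto' hlim key).trans zero_le
  · have hpos : 0 < (Metric.ediam E).toReal := ENNReal.toReal_pos hd hdn
    have hle : (Metric.ediam E).toReal ≤ 1 := ENNReal.toReal_le_of_le_ofReal zero_le_one (by simpa)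
    -- Choose the scale with `N^{-(n+1)} < diam E ≤ N^{-n}`; passing between the two ends costs the
    -- factor `p`.
    obtain ⟨n, h1, h2⟩ := exists_nat_pow_near_of_lt_one hpos hle (inv_pos.2 h0)
      (inv_lt_one_of_one_lt₀ S.one_lt_N)
    have h3 : Metric.ediam E ≤ ENNReal.ofReal ((S.N : ℝ)⁻¹ ^ n) := by
      rw [← ENNReal.ofReal_toReal hdn]
      exact ENNReal.ofReal_le_ofReal h2
    refine (S.selfSimilar_le_of_ediam_le h3).trans ?_
    rw [mul_assoc]
    gcongr
    calc (S.p : ℝ≥0∞)⁻¹ ^ n = S.p * (S.p : ℝ≥0∞)⁻¹ ^ (n + 1) := by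
          rw [pow_succ', ENNReal.mul_inv_cancel_left S.p_ne_zero (by simp)]
      _ ≤ S.p * Metric.ediam E ^ S.dim := by
          rw [inv_p_pow]
          gcongr
          · exact S.dim_nonneg
          · rw [← ENNReal.ofReal_toReal hdn]
            exact ENNReal.ofReal_le_ofReal h1.le

lemma hausdorffMeasure_attractor_pos : 0 < Measure.hausdorffMeasure S.dim S.attractor := by
  have hK : (3 * S.p : ℝ≥0∞) ≠ 0 := mul_ne_zero (by simp) S.p_ne_zero
  have hK' : (3 * S.p : ℝ≥0∞) ≠ ∞ := ENNReal.mul_ne_top (by simp) (by simp)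
  have h : (3 * S.p : ℝ≥0∞)⁻¹ • S.selfSimilar ≤ Measure.hausdorffMeasure S.dim := by
    refine Measure.le_hausdorffMeasure S.dim _ 1 one_pos fun E hE => ?_
    rw [Measure.smul_apply, smul_eq_mul, ENNReal.inv_mul_le_iff hK hK']
    exact S.selfSimilar_le_ediam hE
  refine lt_of_lt_of_le ?_ (h S.attractor)
  rw [Measure.smul_apply, selfSimilar_attractor, smul_eq_mul, mul_one]
  exact ENNReal.inv_pos.2 hK'

lemma hausdorffMeasure_attractor_lt_top : Measure.hausdorffMeasure S.dim S.attractor < ∞ :=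
  S.hausdorffMeasure_attractor_le_one.trans_lt ENNReal.one_lt_top

end AffineIFS

/-! ### The exact value for the middle-third Cantor set -/

lemma cantor_sigma_zero : AffineIFS.cantor.sigma (0 : Fin 2) = fun x => x / 3 := by
  funext x
  change (x + ((0 : ℕ) : ℝ)) / ((3 : ℕ) : ℝ) = x / 3
  norm_num

lemma cantor_sigma_one : AffineIFS.cantor.sigma (1 : Fin 2) = fun x => (2 + x) / 3 := by
  funext x
  change (x + ((2 : ℕ) : ℝ)) / ((3 : ℕ) : ℝ) = (2 + x) / 3
  rw [add_comm]
  norm_num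

lemma cantor_attractor : AffineIFS.cantor.attractor = cantorSet := by
  symm
  refine (AffineIFS.cantor.isAttractor_iff cantorSet).1
    ⟨isCompact_cantorSet, ⟨0, zero_mem_cantorSet⟩, ?_⟩
  -- Only the index type changes, definitionally, so that the union over `Fin 2` can be expanded.
  have h2 : (⋃ i, AffineIFS.cantor.sigma i '' cantorSet) =
      ⋃ i : Fin 2, AffineIFS.cantor.sigma i '' cantorSet := rfl
  rw [h2]
  conv_lhs => rw [cantorSet_eq_union_halves]
  ext x
  simp only [Set.mem_union, Set.mem_iUnion, Fin.exists_fin_two, cantor_sigma_zero, cantor_sigma_one]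

lemma cantor_dim : AffineIFS.cantor.dim = Real.logb 3 2 := by
  change Real.logb ((3 : ℕ) : ℝ) ((2 : ℕ) : ℝ) = _
  norm_num

/-- The part of the Cantor measure of `[a, b]` carried by the construction intervals of order `n`
inside `[a, b]`. -/
def cantorMass : ℕ → ℝ → ℝ → ℝ
  | 0, a, b => open Classical in if a ≤ 0 ∧ 1 ≤ b then 1 else 0
  | n + 1, a, b => (cantorMass n (3 * a) (3 * b) + cantorMass n (3 * a - 2) (3 * b - 2)) / 2

lemma logb_three_two_pos : 0 < Real.logb 3 2 := Real.logb_pos (by norm_num) (by norm_num)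

lemma logb_three_two_le_one : Real.logb 3 2 ≤ 1 := by
  rw [Real.logb_le_iff_le_rpow (by norm_num) (by norm_num)]
  norm_num

lemma three_mul_rpow_logb {x : ℝ} (hx : 0 ≤ x) :
    (3 * x) ^ Real.logb 3 2 = 2 * x ^ Real.logb 3 2 := by
  rw [Real.mul_rpow (by norm_num) hx, Real.rpow_logb (by norm_num) (by norm_num) (by norm_num)]

/-- The key inequality, with `s = log_3 2`. Here `u` and `v` are the lengths inside the two outer
thirds, after scaling by `3`; if both are positive the interval also contains the gap, of length
one. Concavity and `3^s = 2` give `u^s + v^s ≤ (3(u + v)/2)^s`, and `3(u + v)/2 ≤ u + v + 1` since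
`u, v ≤ 1`. -/
lemma rpow_add_rpow_le {u v x : ℝ} (hu0 : 0 ≤ u) (hv0 : 0 ≤ v) (hu1 : u ≤ 1) (hv1 : v ≤ 1)
    (hux : u ≤ x) (hvx : v ≤ x) (h : 0 < u → 0 < v → u + v + 1 ≤ x) :
    u ^ Real.logb 3 2 + v ^ Real.logb 3 2 ≤ x ^ Real.logb 3 2 := by
  have hs := logb_three_two_pos
  rcases hu0.eq_or_lt with rfl | hu
  · rw [Real.zero_rpow hs.ne', zero_add]
    exact Real.rpow_le_rpow hv0 hvx hs.le
  rcases hv0.eq_or_lt with rfl | hv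
  · rw [Real.zero_rpow hs.ne', add_zero]
    exact Real.rpow_le_rpow hu0 hux hs.le
  have hc := (Real.concaveOn_rpow hs.le logb_three_two_le_one).2 hu0 hv0
    (by norm_num : (0 : ℝ) ≤ 1 / 2) (by norm_num : (0 : ℝ) ≤ 1 / 2) (by norm_num)
  simp only [smul_eq_mul] at hc
  have h3 := three_mul_rpow_logb (by positivity : 0 ≤ 1 / 2 * u + 1 / 2 * v)
  have h4 : (3 * (1 / 2 * u + 1 / 2 * v)) ^ Real.logb 3 2 ≤ x ^ Real.logb 3 2 :=
    Real.rpow_le_rpow (by positivity) (by linarith [h hu hv]) hs.le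
  linarith

lemma cantorMass_le (n : ℕ) (a b : ℝ) :
    cantorMass n a b ≤ (max 0 (min b 1 - max a 0)) ^ Real.logb 3 2 := by
  induction n generalizing a b with
  | zero =>
    rw [cantorMass]
    split_ifs with h
    · rw [min_eq_right h.2, max_eq_right h.1]
      norm_num
    · exact Real.rpow_nonneg (le_max_left _ _) _
  | succ n ih =>
    rw [cantorMass, div_le_iff₀ two_pos, mul_comm _ (2 : ℝ), ← three_mul_rpow_logb (le_max_left _ _)]
    refine (add_le_add (ih _ _) (ih _ _)).trans (rpow_add_rpow_le (le_max_left _ _)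
      (le_max_left _ _) ?_ ?_ ?_ ?_ ?_)
    -- The conditions are piecewise linear; the last says that an interval meeting both outer thirds
    -- in positive length contains the middle third.
    all_goals grind

lemma cantor_selfSimilar_Icc (a b : ℝ) :
    AffineIFS.cantor.selfSimilar (Set.Icc a b) =
      2⁻¹ * (AffineIFS.cantor.selfSimilar (Set.Icc (3 * a) (3 * b)) +
        AffineIFS.cantor.selfSimilar (Set.Icc (3 * a - 2) (3 * b - 2))) := by
  have h0 : AffineIFS.cantor.sigma (0 : Fin 2) ⁻¹' Set.Icc a b = Set.Icc (3 * a) (3 * b) := by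
    ext x
    simp only [cantor_sigma_zero, Set.mem_preimage, Set.mem_Icc]
    constructor <;> rintro ⟨h1, h2⟩ <;> constructor <;> linarith
  have h1 : AffineIFS.cantor.sigma (1 : Fin 2) ⁻¹' Set.Icc a b =
      Set.Icc (3 * a - 2) (3 * b - 2) := by
    ext x
    simp only [cantor_sigma_one, Set.mem_preimage, Set.mem_Icc]
    constructor <;> rintro ⟨h1, h2⟩ <;> constructor <;> linarith
  rw [← h0, ← h1]
  exact (AffineIFS.cantor.selfSimilar_apply measurableSet_Icc).trans
    (congrArg₂ (· * ·) (by norm_num [AffineIFS.cantor]) (Fin.sum_univ_two _))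

/-- Widening `[a, b]` by `3^{-n}` at both ends makes it contain every construction interval of order
`n` that it meets. -/
lemma cantor_selfSimilar_le_cantorMass (n : ℕ) (a b : ℝ) :
    AffineIFS.cantor.selfSimilar (Set.Icc a b) ≤
      ENNReal.ofReal (cantorMass n (a - (3 : ℝ)⁻¹ ^ n) (b + (3 : ℝ)⁻¹ ^ n)) := by
  induction n generalizing a b with
  | zero =>
    rw [cantorMass, pow_zero]
    split_ifs with h
    · simpa using prob_le_one
    · refine (AffineIFS.cantor.selfSimilar_eq_zero (Set.disjoint_left.2 fun x hx hx' => ?_)).le.trans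
        zero_le
      have h1 := AffineIFS.cantor.attractor_subset_Icc hx'
      exact h ⟨by linarith [hx.1, h1.2], by linarith [hx.2, h1.1]⟩
  | succ n ih =>
    have hnn : ∀ m a b, 0 ≤ cantorMass m a b := by
      intro m
      induction m with
      | zero => intro a b; rw [cantorMass]; split_ifs <;> norm_num
      | succ m ih => intro a b; rw [cantorMass]; linarith [ih (3 * a) (3 * b), ih (3 * a - 2) (3 * b - 2)]
    rw [cantor_selfSimilar_Icc, cantorMass, div_eq_inv_mul, ENNReal.ofReal_mul (by norm_num),
      ENNReal.ofReal_add (hnn _ _ _) (hnn _ _ _), ENNReal.ofReal_inv_of_pos two_pos,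
      ENNReal.ofReal_ofNat]
    have e : 3 * (3 : ℝ)⁻¹ ^ (n + 1) = (3 : ℝ)⁻¹ ^ n := by rw [pow_succ]; ring
    gcongr
    · exact (ih (3 * a) (3 * b)).trans_eq (by rw [← e, ← mul_sub, ← mul_add])
    · refine (ih (3 * a - 2) (3 * b - 2)).trans_eq ?_
      rw [← e, mul_sub, mul_add, sub_right_comm, sub_add_eq_add_sub]

lemma cantor_selfSimilar_Icc_le {a b : ℝ} (hab : a ≤ b) :
    AffineIFS.cantor.selfSimilar (Set.Icc a b) ≤ ENNReal.ofReal ((b - a) ^ Real.logb 3 2) := by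
  have hs := logb_three_two_pos
  have key : ∀ n : ℕ, AffineIFS.cantor.selfSimilar (Set.Icc a b) ≤
      ENNReal.ofReal ((b - a + 2 * (3 : ℝ)⁻¹ ^ n) ^ Real.logb 3 2) := fun n => by
    refine (cantor_selfSimilar_le_cantorMass n a b).trans (ENNReal.ofReal_le_ofReal
      ((cantorMass_le _ _ _).trans (Real.rpow_le_rpow (le_max_left _ _) ?_ hs.le)))
    have h3 : (0 : ℝ) < 3⁻¹ ^ n := by positivity
    refine max_le (by linarith) ?_
    linarith [min_le_left (b + (3 : ℝ)⁻¹ ^ n) 1, le_max_left (a - (3 : ℝ)⁻¹ ^ n) 0]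
  have h1 : Filter.Tendsto (fun n : ℕ => b - a + 2 * (3 : ℝ)⁻¹ ^ n) Filter.atTop (nhds (b - a)) := by
    simpa using ((tendsto_pow_atTop_nhds_zero_of_lt_one (by norm_num : (0 : ℝ) ≤ 3⁻¹)
      (by norm_num)).const_mul 2).const_add (b - a)
  exact ge_of_tendsto' ((ENNReal.continuous_ofReal.tendsto _).comp
    (((Real.continuous_rpow_const hs.le).tendsto _).comp h1)) key

lemma hausdorffMeasure_cantorSet : Measure.hausdorffMeasure (Real.logb 3 2) cantorSet = 1 := by
  refine le_antisymm ?_ ?_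
  · have := AffineIFS.cantor.hausdorffMeasure_attractor_le_one
    rwa [cantor_attractor, cantor_dim] at this
  · have h : AffineIFS.cantor.selfSimilar ≤ Measure.hausdorffMeasure (Real.logb 3 2) := by
      refine Measure.le_hausdorffMeasure _ _ 1 one_pos fun E hE => ?_
      rcases E.eq_empty_or_nonempty with rfl | hne
      · simp
      have hdn : Metric.ediam E ≠ ∞ := (hE.trans_lt ENNReal.one_lt_top).ne
      have hb : Bornology.IsBounded E := Metric.isBounded_iff_ediam_ne_top.2 hdn
      have hsub : E ⊆ Set.Icc (sInf E) (sSup E) := hb.subset_Icc_sInf_sSup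
      -- Nothing is lost in replacing `E` by the interval from its infimum to its supremum, which
      -- has the same diameter.
      refine (measure_mono hsub).trans ((cantor_selfSimilar_Icc_le ?_).trans ?_)
      · obtain ⟨x, hx⟩ := hne
        exact (hsub hx).1.trans (hsub hx).2
      · rw [← Real.diam_eq hb, Metric.diam, ← ENNReal.ofReal_rpow_of_nonneg ENNReal.toReal_nonneg
          logb_three_two_pos.le, ENNReal.ofReal_toReal hdn]
    have h1 := h cantorSet
    rwa [← cantor_attractor, AffineIFS.selfSimilar_attractor, cantor_attractor] at h1

lemma scaledComp_symm_ae {μ : Measure ℝ} (e : ℝ ≃ᵐ ℝ) {κ : ℝ} (hκ : 0 < κ)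
    (h : μ.map e = ENNReal.ofReal κ • μ) (f : Lp ℂ 2 μ) :
    (scaledComp e hκ h).symm f =ᵐ[μ] fun x => (Real.sqrt κ : ℂ) * f (e.symm x) := by
  have h1 : (scaledComp e hκ h).symm f =ᵐ[μ]
      fun x => (((Real.sqrt κ⁻¹)⁻¹ : ℝ) : ℂ) * f (e.symm x) :=
    MemLp.coeFn_toLp (memLp_scaledComp e.symm (map_symm_scaled e hκ h) f)
  simpa using h1

namespace AffineIFS

variable (S : AffineIFS)

/-! ### Powers of the translation and dilation operators -/

lemma T_symm_ae (f : S.H) : S.T.symm f =ᵐ[S.mu] fun x => f (x + 1) := by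
  filter_upwards [scaledComp_symm_ae shiftEquiv one_pos S.map_shift f] with x hx
  rw [T, hx]
  simp [shiftEquiv]

lemma U_symm_ae (f : S.H) :
    S.U.symm f =ᵐ[S.mu] fun x => (Real.sqrt S.p : ℂ) * f (S.N * x) := by
  filter_upwards [scaledComp_symm_ae S.scaleEquiv S.p_pos S.map_scale f] with x hx
  rw [U, hx]
  simp [scaleEquiv, MeasurableEquiv.mulLeft₀]

lemma ae_shift {P : ℝ → Prop} (h : ∀ᵐ x ∂S.mu, P x) : ∀ᵐ x ∂S.mu, P (x - 1) := by
  filter_upwards [ae_comp_scaled shiftEquiv S.map_shift h] with x hx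
  simpa [shiftEquiv, sub_eq_add_neg] using hx

lemma ae_shift_symm {P : ℝ → Prop} (h : ∀ᵐ x ∂S.mu, P x) : ∀ᵐ x ∂S.mu, P (x + 1) := by
  filter_upwards [ae_comp_scaled shiftEquiv.symm (map_symm_scaled _ one_pos S.map_shift) h] with x hx
  simpa [shiftEquiv] using hx

lemma ae_scale {P : ℝ → Prop} (h : ∀ᵐ x ∂S.mu, P x) : ∀ᵐ x ∂S.mu, P ((S.N : ℝ)⁻¹ * x) := by
  filter_upwards [ae_comp_scaled S.scaleEquiv S.map_scale h] with x hx
  simpa [scaleEquiv] using hx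

lemma ae_scale_symm {P : ℝ → Prop} (h : ∀ᵐ x ∂S.mu, P x) : ∀ᵐ x ∂S.mu, P (S.N * x) := by
  filter_upwards [ae_comp_scaled S.scaleEquiv.symm (map_symm_scaled _ S.p_pos S.map_scale) h] with x hx
  simpa [scaleEquiv, MeasurableEquiv.mulLeft₀] using hx

lemma T_zpow_ae (n : ℤ) (f : S.H) : (S.T ^ n) f =ᵐ[S.mu] fun x => f (x - n) := by
  induction n with
  | zero => simp
  | succ n ih =>
    rw [add_comm, zpow_one_add, LinearIsometryEquiv.coe_mul, Function.comp_apply]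
    filter_upwards [S.T_ae ((S.T ^ (n : ℤ)) f), S.ae_shift ih] with x h1 h2
    rw [h1, h2]
    push_cast
    rw [sub_sub]
  | pred n ih =>
    rw [sub_eq_neg_add, zpow_add, zpow_neg_one, LinearIsometryEquiv.coe_mul, Function.comp_apply,
      LinearIsometryEquiv.inv_def]
    filter_upwards [S.T_symm_ae ((S.T ^ (-n : ℤ)) f), S.ae_shift_symm ih] with x h1 h2
    rw [h1, h2]
    push_cast
    congr 1
    ring

lemma sqrt_p_pos : 0 < Real.sqrt S.p := Real.sqrt_pos.2 S.p_pos

lemma U_zpow_ae (m : ℤ) (f : S.H) : (S.U ^ m) f =ᵐ[S.mu]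
    fun x => ((Real.sqrt S.p ^ (-m) : ℝ) : ℂ) * f ((S.N : ℝ) ^ (-m) * x) := by
  have h0 := S.N_pos
  have hp := S.sqrt_p_pos
  induction m with
  | zero => simp
  | succ m ih =>
    rw [add_comm, zpow_one_add, LinearIsometryEquiv.coe_mul, Function.comp_apply]
    filter_upwards [S.U_ae ((S.U ^ (m : ℤ)) f), S.ae_scale ih] with x h1 h2
    rw [h1, div_eq_inv_mul, h2, ← mul_assoc, ← mul_assoc, ← Complex.ofReal_mul, neg_add,
      zpow_add₀ hp.ne', zpow_add₀ h0.ne', zpow_neg_one, zpow_neg_one, mul_comm (S.N : ℝ)⁻¹]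
  | pred m ih =>
    rw [sub_eq_neg_add, zpow_add, zpow_neg_one, LinearIsometryEquiv.coe_mul, Function.comp_apply,
      LinearIsometryEquiv.inv_def]
    filter_upwards [S.U_symm_ae ((S.U ^ (-m : ℤ)) f), S.ae_scale_symm ih] with x h1 h2
    rw [h1, h2, ← mul_assoc, ← mul_assoc, ← Complex.ofReal_mul, neg_add (-1 : ℤ), neg_neg (1 : ℤ),
      zpow_add₀ hp.ne', zpow_add₀ h0.ne', zpow_one, zpow_one, mul_comm (S.N : ℝ)]

/-! ### The similar copies of the attractor -/

/-- The copy `N^{-n} (C + k)` of the attractor. -/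
def piece (n k : ℤ) : Set ℝ := {x | (S.N : ℝ) ^ n * x - k ∈ S.attractor}

lemma measurableSet_piece (n k : ℤ) : MeasurableSet (S.piece n k) := by
  have : Measurable fun x : ℝ => (S.N : ℝ) ^ n * x - k := by fun_prop
  exact this S.measurableSet_attractor

lemma R_eq_iUnion_piece : S.R = ⋃ nk : ℤ × ℤ, S.piece nk.1 nk.2 := by
  ext x
  simp only [mem_R, Set.mem_iUnion, piece, Set.mem_ofPred_eq, Prod.exists]

lemma piece_subset_Icc (n k : ℤ) :
    S.piece n k ⊆ {x | (k : ℝ) ≤ (S.N : ℝ) ^ n * x ∧ (S.N : ℝ) ^ n * x ≤ k + 1} := by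
  intro x hx
  have := S.attractor_subset_Icc hx
  exact ⟨by linarith [this.1], by linarith [this.2]⟩

lemma piece_eq_iUnion (n k : ℤ) :
    S.piece n k = ⋃ i, S.piece (n + 1) (S.N * k + (S.digit i : ℕ)) := by
  have h0 := S.N_pos
  ext x
  simp only [piece, Set.mem_ofPred_eq, Set.mem_iUnion]
  conv_lhs => rw [attractor_eq_iUnion]
  simp only [Set.mem_iUnion, Set.mem_image]
  refine exists_congr fun i => ?_
  rw [zpow_add_one₀ h0.ne']
  push_cast
  constructor
  · rintro ⟨y, hy, he⟩
    rw [sigma, div_eq_iff h0.ne'] at he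
    convert hy using 1
    linarith
  · intro h
    refine ⟨_, h, ?_⟩
    rw [sigma]
    field_simp
    ring

instance : NullSingletonClass S.mu := by
  have := Measure.nullSingletonClass_hausdorff ℝ S.dim_pos
  refine ⟨fun x => ?_⟩
  rw [mu, Measure.smul_apply, smul_eq_mul]
  exact mul_eq_zero_of_right _ (nonpos_iff_eq_zero.1
    ((Measure.restrict_le_self _).trans_eq (measure_singleton x)))

/-- Copies of one order lie in intervals that share at most an endpoint, and points are null because
`s > 0`. -/
lemma aedisjoint_piece (n : ℤ) {j k : ℤ} (h : j ≠ k) :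
    AEDisjoint S.mu (S.piece n j) (S.piece n k) := by
  have h0 : (0 : ℝ) < (S.N : ℝ) ^ n := zpow_pos S.N_pos n
  refine Set.Subsingleton.measure_zero ?_ _
  rintro x ⟨hxj, hxk⟩ y ⟨hyj, hyk⟩
  have hxj := S.piece_subset_Icc _ _ hxj
  have hyj := S.piece_subset_Icc _ _ hyj
  have hxk := S.piece_subset_Icc _ _ hxk
  have hyk := S.piece_subset_Icc _ _ hyk
  simp only [Set.mem_ofPred_eq] at hxj hyj hxk hyk
  refine mul_left_cancel₀ h0.ne' ?_
  rcases lt_or_gt_of_ne h with h | h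
  · have : (j : ℝ) + 1 ≤ k := by exact_mod_cast h
    linarith
  · have : (k : ℝ) + 1 ≤ j := by exact_mod_cast h
    linarith

lemma mu_attractor : S.mu S.attractor = 1 := by
  have hsub : S.attractor ⊆ S.R := fun x hx => S.mem_R.2 ⟨0, 0, by simpa using hx⟩
  rw [mu, Measure.smul_apply, Measure.restrict_apply S.measurableSet_attractor,
    Set.inter_eq_left.2 hsub, smul_eq_mul]
  exact ENNReal.inv_mul_cancel S.hausdorffMeasure_attractor_pos.ne'
    S.hausdorffMeasure_attractor_lt_top.ne

lemma mu_piece_ne_top (n k : ℤ) : S.mu (S.piece n k) ≠ ∞ := by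
  have h0 : (0 : ℝ) < (S.N : ℝ) ^ n := zpow_pos S.N_pos n
  have hL : LipschitzWith (‖((S.N : ℝ) ^ n)⁻¹‖₊) fun x : ℝ => ((S.N : ℝ) ^ n)⁻¹ * (x + k) := by
    refine LipschitzWith.of_dist_le_mul fun x y => ?_
    rw [coe_nnnorm, Real.dist_eq, Real.dist_eq, ← mul_sub, abs_mul, add_sub_add_right_eq_sub,
      Real.norm_eq_abs]
  have himg : S.piece n k ⊆ (fun x : ℝ => ((S.N : ℝ) ^ n)⁻¹ * (x + k)) '' S.attractor := by
    intro x hx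
    refine ⟨_, hx, ?_⟩
    simp only [sub_add_cancel]
    exact inv_mul_cancel_left₀ h0.ne' x
  rw [mu, Measure.smul_apply, smul_eq_mul]
  refine ENNReal.mul_ne_top (ENNReal.inv_ne_top.2 S.hausdorffMeasure_attractor_pos.ne') ?_
  refine (((Measure.restrict_le_self _).trans (measure_mono himg)).trans_lt
    ((hL.hausdorffMeasure_image_le S.dim_nonneg _).trans_lt ?_)).ne
  exact ENNReal.mul_lt_top (ENNReal.rpow_lt_top_of_nonneg S.dim_nonneg ENNReal.coe_ne_top)
    S.hausdorffMeasure_attractor_lt_top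

lemma setIntegral_piece {E : Type*} [NormedAddCommGroup E] [NormedSpace ℝ E] {h : ℝ → E} {n k : ℤ}
    (hh : IntegrableOn h (S.piece n k) S.mu) :
    ∫ x in S.piece n k, h x ∂S.mu =
      ∑ i, ∫ x in S.piece (n + 1) (S.N * k + (S.digit i : ℕ)), h x ∂S.mu := by
  rw [piece_eq_iUnion] at hh ⊢
  rw [(hasSum_integral_iUnion_ae (fun i => (S.measurableSet_piece _ _).nullMeasurableSet) ?_
    hh).tsum_eq.symm, tsum_fintype]
  intro i j hij
  refine S.aedisjoint_piece _ fun he => hij (S.digit_injective (Fin.ext ?_))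
  simpa using he

lemma integrableOn_piece (f : S.H) (n k : ℤ) : IntegrableOn f (S.piece n k) S.mu :=
  integrableOn_Lp_of_measure_ne_top f fact_one_le_two_ennreal.elim (S.mu_piece_ne_top n k)

/-! ### The copies of the attractor separate `L²` functions -/

/-- Subdivide the piece `j` times, until `g` varies by at most `ε` on each part; there a value of
`g` may be subtracted, as `f` has integral zero. -/
lemma norm_setIntegral_smul_le (f : S.H)
    (hf : ∀ n k : ℤ, ∫ x in S.piece n k, f x ∂S.mu = 0) {g : ℝ → ℝ} (hg : Continuous g)
    {C : ℝ} (hC : ∀ x, ‖g x‖ ≤ C) {r : ℤ} {ε : ℝ}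
    (hosc : ∀ x y, |x - y| ≤ ((S.N : ℝ) ^ r)⁻¹ → |g x - g y| ≤ ε) (j : ℕ) (n k : ℤ)
    (hn : r ≤ n + j) :
    ‖∫ x in S.piece n k, g x • f x ∂S.mu‖ ≤ ε * ∫ x in S.piece n k, ‖f x‖ ∂S.mu := by
  have hint : ∀ n k, IntegrableOn (fun x => g x • f x) (S.piece n k) S.mu := fun n k =>
    (S.integrableOn_piece f n k).bdd_smul C hg.aestronglyMeasurable (.of_forall hC)
  induction j generalizing n k with
  | zero =>
    have hn : r ≤ n := by simpa using hn
    have h0 : (0 : ℝ) < (S.N : ℝ) ^ n := zpow_pos S.N_pos n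
    have h0' : (0 : ℝ) < (S.N : ℝ) ^ r := zpow_pos S.N_pos r
    rcases (S.piece n k).eq_empty_or_nonempty with he | ⟨y, hy⟩
    · simp [he]
    have e : ∫ x in S.piece n k, g x • f x ∂S.mu = ∫ x in S.piece n k, (g x - g y) • f x ∂S.mu := by
      simp_rw [sub_smul]
      have hy := (S.integrableOn_piece f n k).integrable.smul (g y)
      rw [integral_sub (g := fun x => g y • f x) (hint n k) hy, integral_smul, hf, smul_zero,
        sub_zero]
    rw [e, ← integral_const_mul]
    refine norm_integral_le_of_norm_le ((S.integrableOn_piece f n k).norm.const_mul ε) ?_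
    refine (ae_restrict_mem (S.measurableSet_piece n k)).mono fun x hx => ?_
    rw [norm_smul]
    gcongr
    refine hosc x y ?_
    have h1 := S.piece_subset_Icc _ _ hx
    have h2 := S.piece_subset_Icc _ _ hy
    simp only [Set.mem_ofPred_eq] at h1 h2
    have h3 : |(S.N : ℝ) ^ n * (x - y)| ≤ 1 := by
      rw [abs_le]
      constructor <;> linarith
    rw [abs_mul, abs_of_pos h0] at h3
    refine ((le_inv_mul_iff₀ h0).2 h3).trans ?_
    rw [mul_one]
    exact inv_anti₀ h0' (zpow_le_zpow_right₀ S.one_lt_N.le hn)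
  | succ j ih =>
    rw [S.setIntegral_piece (hint n k), S.setIntegral_piece (S.integrableOn_piece f n k).norm,
      Finset.mul_sum]
    refine (norm_sum_le _ _).trans (Finset.sum_le_sum fun i _ => ih _ _ ?_)
    push_cast at hn
    omega

/-- Smooth compactly supported test functions are uniformly continuous, so the previous bound
applies with every `ε > 0` and `f` vanishes almost everywhere on each piece. Countably many pieces
cover `R`. -/
lemma eq_zero_of_setIntegral_piece_eq_zero (f : S.H)
    (hf : ∀ n k : ℤ, ∫ x in S.piece n k, f x ∂S.mu = 0) : f = 0 := by
  have h0 := S.N_pos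
  have hpiece : ∀ n k, ∀ᵐ x ∂S.mu.restrict (S.piece n k), f x = 0 := by
    intro n k
    refine ae_eq_zero_of_integral_contDiff_smul_eq_zero
      (Integrable.locallyIntegrable (S.integrableOn_piece f n k)) fun g hg hgc => ?_
    obtain ⟨C, hC⟩ := hgc.exists_bound_of_continuous hg.continuous
    have huc := Metric.uniformContinuous_iff.1 (hgc.uniformContinuous_of_continuous hg.continuous)
    set I := ∫ x in S.piece n k, ‖f x‖ ∂S.mu
    have hI : 0 ≤ I := integral_nonneg fun _ => norm_nonneg _
    have key : ∀ ε > 0, ‖∫ x in S.piece n k, g x • f x ∂S.mu‖ ≤ ε * I := by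
      intro ε hε
      obtain ⟨δ, hδ, hd⟩ := huc ε hε
      obtain ⟨r, hr⟩ := exists_pow_lt_of_lt_one hδ (inv_lt_one_of_one_lt₀ S.one_lt_N)
      refine S.norm_setIntegral_smul_le f hf hg.continuous hC (r := r) (fun x y hxy => ?_)
        (r - n).toNat n k (by omega)
      rw [zpow_natCast, ← inv_pow] at hxy
      exact (hd (hxy.trans_lt hr)).le
    have hlim : Filter.Tendsto (fun ε : ℝ => ε * I) (nhdsWithin 0 (Set.Ioi 0)) (nhds 0) := by
      have : Filter.Tendsto (fun ε : ℝ => ε * I) (nhds 0) (nhds (0 * I)) :=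
        (continuous_id.mul continuous_const).tendsto 0
      rw [zero_mul] at this
      exact this.mono_left nhdsWithin_le_nhds
    exact norm_le_zero_iff.1 (ge_of_tendsto hlim (eventually_mem_nhdsWithin.mono key))
  refine Lp.ext ?_
  have hR : S.mu.restrict S.R = S.mu := by
    rw [mu, Measure.restrict_smul, Measure.restrict_restrict S.measurableSet_R, Set.inter_self]
  have : ∀ᵐ x ∂S.mu.restrict S.R, f x = 0 := by
    rw [R_eq_iUnion_piece, ae_restrict_iUnion_iff]
    exact fun nk => hpiece nk.1 nk.2
  rw [hR] at this
  filter_upwards [this, Lp.coeFn_zero ℂ 2 S.mu] with x h1 h2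
  rw [h1, h2, Pi.zero_apply]

/-! ### The multiresolution vectors -/

lemma phi_ae : S.phi =ᵐ[S.mu] S.attractor.indicator fun _ => 1 := indicatorConstLp_coeFn

lemma ae_T_zpow {P : ℝ → Prop} (h : ∀ᵐ x ∂S.mu, P x) (k : ℤ) : ∀ᵐ x ∂S.mu, P (x - k) := by
  induction k with
  | zero => simpa using h
  | succ k ih =>
    filter_upwards [S.ae_shift ih] with x hx
    push_cast
    rwa [sub_sub, add_comm] at hx
  | pred k ih =>
    filter_upwards [S.ae_shift_symm ih] with x hx
    convert hx using 1
    push_cast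
    ring

lemma ae_U_zpow {P : ℝ → Prop} (h : ∀ᵐ x ∂S.mu, P x) (m : ℤ) :
    ∀ᵐ x ∂S.mu, P ((S.N : ℝ) ^ m * x) := by
  have h0 := S.N_pos
  induction m with
  | zero => simpa using h
  | succ m ih =>
    filter_upwards [S.ae_scale_symm ih] with x hx
    rwa [zpow_add_one₀ h0.ne', mul_assoc]
  | pred m ih =>
    filter_upwards [S.ae_scale ih] with x hx
    rwa [zpow_sub_one₀ h0.ne', mul_assoc]

lemma U_zpow_T_zpow_ae (m n : ℤ) (f : S.H) : (S.U ^ m) ((S.T ^ n) f) =ᵐ[S.mu]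
    fun x => ((Real.sqrt S.p ^ (-m) : ℝ) : ℂ) * f ((S.N : ℝ) ^ (-m) * x - n) := by
  filter_upwards [S.U_zpow_ae m ((S.T ^ n) f), S.ae_U_zpow (S.T_zpow_ae n f) (-m)] with x h1 h2
  rw [h1, h2]

lemma U_zpow_T_zpow_phi (m k : ℤ) : (S.U ^ m) ((S.T ^ k) S.phi) =
    ((Real.sqrt S.p ^ (-m) : ℝ) : ℂ) •
      indicatorConstLp 2 (S.measurableSet_piece (-m) k) (S.mu_piece_ne_top (-m) k) (1 : ℂ) := by
  refine Lp.ext ?_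
  filter_upwards [S.U_zpow_T_zpow_ae m k S.phi, S.ae_U_zpow (S.ae_T_zpow S.phi_ae k) (-m),
    Lp.coeFn_smul ((Real.sqrt S.p ^ (-m) : ℝ) : ℂ)
      (indicatorConstLp 2 (S.measurableSet_piece (-m) k) (S.mu_piece_ne_top (-m) k) (1 : ℂ)),
    indicatorConstLp_coeFn (p := 2) (hs := S.measurableSet_piece (-m) k)
      (hμs := S.mu_piece_ne_top (-m) k) (c := (1 : ℂ))] with x h1 h2 h3 h4
  rw [h1, h2, h3, Pi.smul_apply, h4, smul_eq_mul]
  rfl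

lemma orthonormal_T_zpow_phi : Orthonormal ℂ fun k : ℤ => (S.T ^ k) S.phi := by
  constructor
  · intro k
    rw [LinearIsometryEquiv.norm_map, phi, norm_indicatorConstLp (by simp) (by simp),
      Measure.real, mu_attractor]
    simp
  · intro j k hjk
    have h1 := S.U_zpow_T_zpow_phi 0 j
    have h2 := S.U_zpow_T_zpow_phi 0 k
    simp only [zpow_zero, neg_zero, Complex.ofReal_one, one_smul] at h1 h2
    change (S.T ^ j) S.phi = _ at h1
    change (S.T ^ k) S.phi = _ at h2
    beta_reduce
    rw [h1, h2, L2.inner_indicatorConstLp_one_indicatorConstLp_one _ _ (S.mu_piece_ne_top _ _)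
      (S.mu_piece_ne_top _ _), Measure.real, S.aedisjoint_piece 0 hjk]
    simp

lemma eq_zero_of_inner_eq_zero (f : S.H)
    (hf : ∀ m k : ℤ, inner ℂ ((S.U ^ m) ((S.T ^ k) S.phi)) f = 0) : f = 0 := by
  refine S.eq_zero_of_setIntegral_piece_eq_zero f fun n k => ?_
  have h := hf (-n) k
  rw [U_zpow_T_zpow_phi, inner_smul_left] at h
  have hne : (starRingEnd ℂ) ((Real.sqrt S.p ^ (- -n) : ℝ) : ℂ) ≠ 0 := by
    rw [Complex.conj_ofReal, Complex.ofReal_ne_zero]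
    exact (zpow_pos S.sqrt_p_pos _).ne'
  have h2 := (mul_eq_zero.1 h).resolve_left hne
  rw [L2.inner_indicatorConstLp_one] at h2
  simpa using h2

end AffineIFS

/-- Orthogonality of the characters of `ℤ / p`. -/
lemma sum_conj_exp_mul_exp {p : ℕ} (hp : p ≠ 0) {j k : ℕ} (hj : j < p) (hk : k < p) :
    ∑ i : Fin p, (starRingEnd ℂ) (Complex.exp (2 * Real.pi * Complex.I / p) ^ (j * (i : ℕ))) *
      Complex.exp (2 * Real.pi * Complex.I / p) ^ (k * (i : ℕ)) = if j = k then (p : ℂ) else 0 := by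
  have hη : IsPrimitiveRoot (Complex.exp (2 * Real.pi * Complex.I / p)) p :=
    Complex.isPrimitiveRoot_exp p hp
  set η := Complex.exp (2 * Real.pi * Complex.I / p)
  have hη0 : η ≠ 0 := Complex.exp_ne_zero _
  have hconj : (starRingEnd ℂ) η = η⁻¹ :=
    (Complex.inv_eq_conj (Complex.norm_eq_one_of_pow_eq_one hη.pow_eq_one hp)).symm
  have e : ∀ i : Fin p, (starRingEnd ℂ) (η ^ (j * (i : ℕ))) * η ^ (k * (i : ℕ)) =
      (η ^ k / η ^ j) ^ (i : ℕ) := by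
    intro i
    rw [map_pow, hconj, inv_pow, pow_mul, pow_mul, div_pow, div_eq_inv_mul]
  simp only [e]
  rw [Fin.sum_univ_eq_sum_range fun i => (η ^ k / η ^ j) ^ i]
  split_ifs with h
  · rw [h, div_self (pow_ne_zero _ hη0)]
    simp
  · have h1 : η ^ k / η ^ j ≠ 1 := by
      rw [Ne, div_eq_one_iff_eq (pow_ne_zero _ hη0)]
      exact fun h' => h (hη.pow_inj hk hj h').symm
    rw [geom_sum_eq h1, div_pow, ← pow_mul, ← pow_mul, mul_comm k, mul_comm j, pow_mul, pow_mul,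
      hη.pow_eq_one]
    simp

namespace AffineIFS

variable (S : AffineIFS)

/-! ### Filters -/

lemma filterOp_C_mul_X_pow (c : ℂ) (d : ℕ) (f : S.H) :
    S.filterOp (C c * X ^ d) f = c • (S.T ^ (d : ℤ)) f := by
  have h : ∀ (d : ℕ) (f : S.H),
      ((S.T.toLinearEquiv.toLinearMap : Module.End ℂ S.H) ^ d) f = (S.T ^ (d : ℤ)) f := by
    intro d
    induction d with
    | zero => intro f; simp
    | succ d ih =>
      intro f
      rw [pow_succ, Module.End.mul_apply, ih, Nat.cast_succ, zpow_add_one]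
      rfl
  rw [filterOp, map_mul, aeval_C, map_pow, aeval_X, Module.End.mul_apply, h,
    Module.algebraMap_end_apply]

lemma filterOp_X_pow (d : ℕ) (f : S.H) : S.filterOp (X ^ d) f = (S.T ^ (d : ℤ)) f := by
  simpa using S.filterOp_C_mul_X_pow 1 d f

lemma T_zpow_T_zpow (j k : ℤ) (f : S.H) : (S.T ^ j) ((S.T ^ k) f) = (S.T ^ (j + k)) f := by
  rw [zpow_add]; rfl

lemma U_zpow_U_zpow (j k : ℤ) (f : S.H) : (S.U ^ j) ((S.U ^ k) f) = (S.U ^ (j + k)) f := by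
  rw [zpow_add]; rfl

lemma U_zpow_U (j : ℤ) (f : S.H) : (S.U ^ j) (S.U f) = (S.U ^ (j + 1)) f := by
  rw [zpow_add_one]; rfl

/-- The commutation relation between dilation and translations. -/
lemma U_T_zpow (n : ℤ) (f : S.H) : S.U ((S.T ^ n) f) = (S.T ^ (S.N * n)) (S.U f) := by
  have h0 := S.N_pos
  refine Lp.ext ?_
  filter_upwards [S.U_ae ((S.T ^ n) f), S.ae_scale (S.T_zpow_ae n f),
    S.T_zpow_ae (S.N * n) (S.U f), S.ae_T_zpow (S.U_ae f) (S.N * n)] with x h1 h2 h3 h4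
  rw [h1, div_eq_inv_mul, h2, h3, h4]
  congr 2
  push_cast
  field_simp

/-- The vector `T^{Nn} m(T) φ` of the filter `m = p^{-1/2} ∑_i η^{k (i - 1)} z^{a_i}`. -/
def dftVec (k : ℕ) (n : ℤ) : S.H := (S.T ^ (S.N * n)) (S.filterOp (S.dftFilter k) S.phi)

/-- The coefficient `p^{-1/2} η^{k i}`. -/
def dftCoeff (k i : ℕ) : ℂ :=
  (((Real.sqrt S.p)⁻¹ : ℝ) : ℂ) * Complex.exp (2 * Real.pi * Complex.I / S.p) ^ (k * i)

lemma dftCoeff_zero (i : ℕ) : S.dftCoeff 0 i = (((Real.sqrt S.p)⁻¹ : ℝ) : ℂ) := by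
  simp [dftCoeff]

lemma dftCoeff_comm (k i : ℕ) : S.dftCoeff k i = S.dftCoeff i k := by
  rw [dftCoeff, dftCoeff, mul_comm k]

lemma filterOp_dftFilter (k : ℕ) (f : S.H) : S.filterOp (S.dftFilter k) f =
    ∑ i : Fin S.p, S.dftCoeff k i • (S.T ^ ((S.digit i : ℕ) : ℤ)) f := by
  rw [dftFilter, filterOp, map_sum, LinearMap.sum_apply]
  exact Finset.sum_congr rfl fun i _ => S.filterOp_C_mul_X_pow _ _ _

lemma dftVec_eq (k : ℕ) (n : ℤ) : S.dftVec k n =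
    ∑ i : Fin S.p, S.dftCoeff k i • (S.T ^ (S.N * n + (S.digit i : ℕ))) S.phi := by
  rw [dftVec, filterOp_dftFilter, map_sum]
  refine Finset.sum_congr rfl fun i _ => ?_
  rw [map_smul, T_zpow_T_zpow]

lemma sum_conj_dftCoeff_mul {j k : ℕ} (hj : j < S.p) (hk : k < S.p) :
    ∑ i : Fin S.p, (starRingEnd ℂ) (S.dftCoeff j i) * S.dftCoeff k i = if j = k then 1 else 0 := by
  have hp : (S.p : ℂ) ≠ 0 := by exact_mod_cast S.p_pos.ne'
  have e : ∀ i : Fin S.p, (starRingEnd ℂ) (S.dftCoeff j i) * S.dftCoeff k i = (S.p : ℂ)⁻¹ *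
      ((starRingEnd ℂ) (Complex.exp (2 * Real.pi * Complex.I / S.p) ^ (j * (i : ℕ))) *
      Complex.exp (2 * Real.pi * Complex.I / S.p) ^ (k * (i : ℕ))) := by
    intro i
    have hs : (((Real.sqrt S.p)⁻¹ : ℝ) : ℂ) * (((Real.sqrt S.p)⁻¹ : ℝ) : ℂ) = (S.p : ℂ)⁻¹ := by
      rw [← Complex.ofReal_mul, ← mul_inv, Real.mul_self_sqrt S.p_pos.le]
      simp
    rw [dftCoeff, dftCoeff, map_mul, Complex.conj_ofReal, ← hs]
    ring
  simp only [e]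
  rw [← Finset.mul_sum, sum_conj_exp_mul_exp (by rintro h; simp [h] at hp) hj hk]
  split_ifs
  · exact inv_mul_cancel₀ hp
  · exact mul_zero _

/-- Fourier inversion: the inverse of the unitary matrix `dftCoeff` is its conjugate transpose. -/
lemma T_zpow_phi_eq_sum_dftVec (n : ℤ) (i : Fin S.p) :
    (S.T ^ (S.N * n + (S.digit i : ℕ))) S.phi =
      ∑ k : Fin S.p, (starRingEnd ℂ) (S.dftCoeff k i) • S.dftVec k n := by
  simp only [dftVec_eq, Finset.smul_sum, smul_smul]
  rw [Finset.sum_comm]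
  simp only [← Finset.sum_smul]
  have e : ∀ j : Fin S.p, ∑ k : Fin S.p, (starRingEnd ℂ) (S.dftCoeff k i) * S.dftCoeff k j =
      if i = j then 1 else 0 := by
    intro j
    -- The matrix is symmetric, so orthogonality of its columns is orthogonality of its rows.
    simp only [S.dftCoeff_comm _ (i : ℕ), S.dftCoeff_comm _ (j : ℕ)]
    rw [S.sum_conj_dftCoeff_mul i.2 j.2]
    simp only [Fin.ext_iff]
  simp [e]

lemma lowPass_eq : S.lowPass = S.dftFilter 0 := by
  simp [lowPass, dftFilter]

/-- The scaling equation. -/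
lemma U_phi : S.U S.phi = S.filterOp S.lowPass S.phi := by
  have h0 := S.N_pos
  have h1 := S.U_zpow_T_zpow_phi 1 0
  have h2 : ∀ k : ℤ, (S.T ^ k) S.phi =
      indicatorConstLp 2 (S.measurableSet_piece 0 k) (S.mu_piece_ne_top 0 k) (1 : ℂ) := by
    intro k
    have := S.U_zpow_T_zpow_phi 0 k
    simpa using this
  simp only [zpow_one, zpow_zero, zpow_neg_one] at h1
  change S.U S.phi = _ at h1
  rw [h1, lowPass_eq, filterOp_dftFilter]
  simp only [dftCoeff_zero]
  rw [← Finset.smul_sum]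
  congr 1
  -- The set `N C` is the union of the translates `C + a_i`. Almost every point is in at most one of
  -- them, so the indicator of the union is the sum of the indicators.
  have hdis : ∀ᵐ x ∂S.mu, ∀ i j : Fin S.p, i ≠ j →
      ¬ (x ∈ S.piece 0 (S.digit i : ℕ) ∧ x ∈ S.piece 0 (S.digit j : ℕ)) := by
    refine ae_all_iff.2 fun i => ae_all_iff.2 fun j => ?_
    rcases eq_or_ne i j with hij | hij
    · exact .of_forall fun x h => absurd hij h
    refine Filter.Eventually.mono ?_ fun x hx _ => hx
    refine measure_eq_zero_iff_ae_notMem.1 (S.aedisjoint_piece 0 fun he => hij ?_)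
    exact S.digit_injective (Fin.ext (by exact_mod_cast he))
  have hind : ∀ᵐ x ∂S.mu, ∀ i : Fin S.p, (S.T ^ ((S.digit i : ℕ) : ℤ)) S.phi x =
      (S.piece 0 (S.digit i : ℕ)).indicator (fun _ => 1) x := by
    refine ae_all_iff.2 fun i => ?_
    rw [h2]
    exact indicatorConstLp_coeFn
  have hsum : ∀ᵐ x ∂S.mu, (∑ i : Fin S.p, (S.T ^ ((S.digit i : ℕ) : ℤ)) S.phi : S.H) x =
      ∑ i : Fin S.p, (S.T ^ ((S.digit i : ℕ) : ℤ)) S.phi x := by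
    filter_upwards [Lp.coeFn_finsetSum Finset.univ
      fun i : Fin S.p => (S.T ^ ((S.digit i : ℕ) : ℤ)) S.phi] with x hx
    rw [hx, Finset.sum_apply]
  refine Lp.ext ?_
  filter_upwards [hdis, hind, hsum, indicatorConstLp_coeFn (p := 2)
    (hs := S.measurableSet_piece (-1) 0) (hμs := S.mu_piece_ne_top (-1) 0) (c := (1 : ℂ))]
    with x hx1 hx2 hx3 hx4
  rw [hx3, hx4]
  simp only [hx2]
  have hmem : x ∈ S.piece (-1) 0 ↔ ∃ i, x ∈ S.piece 0 (S.digit i : ℕ) := by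
    rw [piece_eq_iUnion, Set.mem_iUnion]
    simp
  by_cases h : ∃ i, x ∈ S.piece 0 (S.digit i : ℕ)
  · rw [Set.indicator_of_mem (hmem.2 h)]
    obtain ⟨i, hi⟩ := h
    rw [Finset.sum_eq_single i, Set.indicator_of_mem hi]
    · intro j _ hj
      exact Set.indicator_of_notMem (fun hj' => hx1 i j hj.symm ⟨hi, hj'⟩) _
    · simp
  · rw [Set.indicator_of_notMem fun h' => h (hmem.1 h')]
    push Not at h
    exact (Finset.sum_eq_zero fun i _ => Set.indicator_of_notMem (h i) _).symm

lemma U_T_zpow_phi (n : ℤ) : S.U ((S.T ^ n) S.phi) = S.dftVec 0 n := by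
  rw [U_T_zpow, U_phi, lowPass_eq, dftVec]

/-- Applying `U` removes the `U⁻¹` in the definition of the wavelets, so inner products reduce to
those of translates of `φ`. -/
lemma U_T_zpow_psi (n : ℤ) (i : S.WaveletIndex) :
    S.U ((S.T ^ n) (S.psi i)) = (S.T ^ (S.N * n)) (S.filterOp (S.highPass i) S.phi) := by
  rw [U_T_zpow, psi, LinearIsometryEquiv.apply_symm_apply]

lemma U_T_zpow_psi_inl (n : ℤ) (d : {d : Fin S.N // d ∉ Set.range S.digit}) :
    S.U ((S.T ^ n) (S.psi (Sum.inl d))) = (S.T ^ (S.N * n + ((d : Fin S.N) : ℕ))) S.phi := by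
  rw [U_T_zpow_psi, highPass, filterOp_X_pow, T_zpow_T_zpow]

lemma U_T_zpow_psi_inr (n : ℤ) (j : Fin (S.p - 1)) :
    S.U ((S.T ^ n) (S.psi (Sum.inr j))) = S.dftVec (j + 1) n := by
  rw [U_T_zpow_psi, highPass, dftVec]

/-! ### Orthogonality relations -/

lemma inner_T_zpow_phi (j k : ℤ) :
    inner ℂ ((S.T ^ j) S.phi) ((S.T ^ k) S.phi) = if j = k then (1 : ℂ) else 0 :=
  orthonormal_iff_ite.1 S.orthonormal_T_zpow_phi j k

lemma N_mul_add_inj {n n' : ℤ} {d d' : Fin S.N} :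
    S.N * n + ((d : ℕ) : ℤ) = S.N * n' + ((d' : ℕ) : ℤ) ↔ n = n' ∧ d = d' := by
  constructor
  · intro h
    have hN : (0 : ℤ) < S.N := by have := S.two_le_N; omega
    have h1 := congrArg (· / (S.N : ℤ)) h
    have h2 : ∀ d : Fin S.N, ((d : ℕ) : ℤ) / S.N = 0 := fun d =>
      Int.ediv_eq_zero_of_lt (by positivity) (by exact_mod_cast d.2)
    simp only [Int.mul_add_ediv_left _ _ hN.ne', h2, add_zero] at h1
    refine ⟨h1, Fin.ext ?_⟩
    rw [h1] at h
    exact_mod_cast add_left_cancel h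
  · rintro ⟨rfl, rfl⟩
    rfl

lemma inner_dftVec {j k : ℕ} (hj : j < S.p) (hk : k < S.p) (n n' : ℤ) :
    inner ℂ (S.dftVec j n) (S.dftVec k n') = if n = n' ∧ j = k then (1 : ℂ) else 0 := by
  simp only [dftVec_eq, sum_inner, inner_sum, inner_smul_left, inner_smul_right, inner_T_zpow_phi,
    N_mul_add_inj, S.digit_injective.eq_iff]
  by_cases h : n = n'
  · simp only [h, true_and, mul_ite, mul_one, mul_zero, Finset.sum_ite_eq', Finset.mem_univ,
      if_true]
    exact (Finset.sum_congr rfl fun i _ => mul_comm _ _).trans (S.sum_conj_dftCoeff_mul hj hk)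
  · simp [h]

lemma inner_T_zpow_phi_dftVec {d : Fin S.N} (hd : d ∉ Set.range S.digit) (k : ℕ) (n n' : ℤ) :
    inner ℂ ((S.T ^ (S.N * n + (d : ℕ))) S.phi) (S.dftVec k n') = 0 := by
  have : ∀ i, d ≠ S.digit i := fun i h => hd ⟨i, h.symm⟩
  simp [dftVec_eq, inner_sum, inner_smul_right, inner_T_zpow_phi, N_mul_add_inj, this]

lemma inner_T_zpow_psi (n n' : ℤ) (i i' : S.WaveletIndex) :
    inner ℂ ((S.T ^ n) (S.psi i)) ((S.T ^ n') (S.psi i')) =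
      open Classical in if n = n' ∧ i = i' then (1 : ℂ) else 0 := by
  rw [← S.U.inner_map_map]
  rcases i with d | j <;> rcases i' with d' | j'
  · rw [U_T_zpow_psi_inl, U_T_zpow_psi_inl, inner_T_zpow_phi]
    simp only [N_mul_add_inj, Sum.inl.injEq, Subtype.ext_iff]
  · rw [U_T_zpow_psi_inl, U_T_zpow_psi_inr, S.inner_T_zpow_phi_dftVec d.2]
    simp
  · rw [U_T_zpow_psi_inl, U_T_zpow_psi_inr, inner_eq_zero_symm.1 (S.inner_T_zpow_phi_dftVec d'.2 _ _ _)]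
    simp
  · rw [U_T_zpow_psi_inr, U_T_zpow_psi_inr, S.inner_dftVec (by omega) (by omega)]
    simp only [add_left_inj, Sum.inr.injEq, Fin.ext_iff]

lemma inner_T_zpow_psi_phi (n k : ℤ) (i : S.WaveletIndex) :
    inner ℂ ((S.T ^ n) (S.psi i)) ((S.T ^ k) S.phi) = 0 := by
  rw [← S.U.inner_map_map, U_T_zpow_phi]
  rcases i with d | j
  · rw [U_T_zpow_psi_inl, S.inner_T_zpow_phi_dftVec d.2]
  · rw [U_T_zpow_psi_inr, S.inner_dftVec (by omega) (by have := S.two_le_p; omega)]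
    simp

/-- The span of the integer translates of the scaling function. -/
def scalingSpace : Submodule ℂ S.H := Submodule.span ℂ (Set.range fun k : ℤ => (S.T ^ k) S.phi)

lemma T_zpow_phi_mem (k : ℤ) : (S.T ^ k) S.phi ∈ S.scalingSpace := Submodule.subset_span ⟨k, rfl⟩

lemma dftVec_mem (k : ℕ) (n : ℤ) : S.dftVec k n ∈ S.scalingSpace := by
  rw [dftVec_eq]
  exact Submodule.sum_mem _ fun i _ => Submodule.smul_mem _ _ (S.T_zpow_phi_mem _)

/-- Invariance under `U` puts all wavelets of higher level into the span of the `T^k φ`, to which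
wavelets of level zero are orthogonal. The algebraic span suffices; no closure is needed. -/
lemma U_mem_scalingSpace {f : S.H} (hf : f ∈ S.scalingSpace) : S.U f ∈ S.scalingSpace := by
  induction hf using Submodule.span_induction with
  | mem x hx =>
    obtain ⟨k, rfl⟩ := hx
    change S.U ((S.T ^ k) S.phi) ∈ _
    rw [U_T_zpow_phi]
    exact S.dftVec_mem _ _
  | zero => rw [map_zero]; exact Submodule.zero_mem _
  | add x y _ _ hx hy => rw [map_add]; exact Submodule.add_mem _ hx hy
  | smul c x _ hx => rw [map_smul]; exact Submodule.smul_mem _ _ hx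

lemma U_zpow_T_zpow_psi_mem (r : ℕ) (n : ℤ) (i : S.WaveletIndex) :
    (S.U ^ ((r : ℤ) + 1)) ((S.T ^ n) (S.psi i)) ∈ S.scalingSpace := by
  induction r with
  | zero =>
    rw [Nat.cast_zero, zero_add, zpow_one]
    rcases i with d | j
    · rw [U_T_zpow_psi_inl]
      exact S.T_zpow_phi_mem _
    · rw [U_T_zpow_psi_inr]
      exact S.dftVec_mem _ _
  | succ r ih =>
    rw [Nat.cast_succ, add_comm _ (1 : ℤ), zpow_one_add]
    exact S.U_mem_scalingSpace ih

lemma inner_T_zpow_psi_of_mem (n : ℤ) (i : S.WaveletIndex) {f : S.H} (hf : f ∈ S.scalingSpace) :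
    inner ℂ ((S.T ^ n) (S.psi i)) f = 0 := by
  induction hf using Submodule.span_induction with
  | mem x hx =>
    obtain ⟨k, rfl⟩ := hx
    exact S.inner_T_zpow_psi_phi n k i
  | zero => exact inner_zero_right _
  | add x y _ _ hx hy => rw [inner_add_right, hx, hy, add_zero]
  | smul c x _ hx => rw [inner_smul_right, hx, mul_zero]

/-- The wavelet system `U^m T^n ψ_i`. -/
def wavelet (q : ℤ × ℤ × S.WaveletIndex) : S.H := (S.U ^ q.1) ((S.T ^ q.2.1) (S.psi q.2.2))

lemma inner_wavelet_of_lt {m m' : ℤ} (h : m < m') (n n' : ℤ) (i i' : S.WaveletIndex) :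
    inner ℂ (S.wavelet (m, n, i)) (S.wavelet (m', n', i')) = 0 := by
  obtain ⟨r, hr⟩ := Int.eq_ofNat_of_zero_le (by omega : 0 ≤ m' - m - 1)
  -- Cancel the common `U^m`; at least one factor `U` remains on the right, which moves that wavelet
  -- into `scalingSpace`.
  have e : m' = m + (r + 1) := by omega
  simp only [wavelet]
  rw [e, ← U_zpow_U_zpow, LinearIsometryEquiv.inner_map_map]
  exact S.inner_T_zpow_psi_of_mem n i (S.U_zpow_T_zpow_psi_mem r n' i')

lemma orthonormal_wavelet : Orthonormal ℂ S.wavelet := by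
  classical
  rw [orthonormal_iff_ite]
  rintro ⟨m, n, i⟩ ⟨m', n', i'⟩
  rcases lt_trichotomy m m' with h | rfl | h
  · rw [S.inner_wavelet_of_lt h, if_neg]
    simp [h.ne]
  · simp only [wavelet, LinearIsometryEquiv.inner_map_map, inner_T_zpow_psi, Prod.mk.injEq,
      true_and]
  · rw [inner_eq_zero_symm.1 (S.inner_wavelet_of_lt h _ _ _ _), if_neg]
    simp [h.ne']

/-! ### Completeness -/

/-- Divide `k` by `N`. If the remainder is a missing digit, `U^m T^k φ` is itself a wavelet.
Otherwise expand it in the Fourier vectors: all but the low-pass one are wavelets, and that one has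
coefficient `p^{-1/2}`. -/
lemma norm_inner_le_of_forall_wavelet {f : S.H} (hf : ∀ q, inner ℂ (S.wavelet q) f = 0)
    (m k : ℤ) : ∃ k' : ℤ, ‖inner ℂ ((S.U ^ m) ((S.T ^ k) S.phi)) f‖ ≤
      (Real.sqrt S.p)⁻¹ * ‖inner ℂ ((S.U ^ (m + 1)) ((S.T ^ k') S.phi)) f‖ := by
  have hN : (0 : ℤ) < S.N := by have := S.two_le_N; omega
  have hp := S.sqrt_p_pos
  refine ⟨k / S.N, ?_⟩
  set n := k / (S.N : ℤ)
  obtain ⟨d, hd⟩ : ∃ d : Fin S.N, k = S.N * n + ((d : ℕ) : ℤ) := by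
    refine ⟨⟨(k % S.N).toNat, ?_⟩, ?_⟩
    · have := Int.emod_lt_of_pos k hN
      omega
    · have h1 := Int.emod_nonneg k hN.ne'
      have h2 := Int.mul_ediv_add_emod k S.N
      simp only [Int.toNat_of_nonneg h1]
      exact h2.symm
  have hw : ∀ i, inner ℂ ((S.U ^ m) (S.U ((S.T ^ n) (S.psi i)))) f = 0 := by
    intro i
    rw [U_zpow_U]
    exact hf (m + 1, n, i)
  by_cases h : d ∈ Set.range S.digit
  · obtain ⟨i, rfl⟩ := h
    rw [hd, T_zpow_phi_eq_sum_dftVec, map_sum, sum_inner,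
      Finset.sum_eq_single (⟨0, by have := S.two_le_p; omega⟩ : Fin S.p)]
    · rw [map_smul, inner_smul_left, ← U_T_zpow_phi, U_zpow_U, norm_mul, dftCoeff_zero]
      rw [Complex.conj_ofReal, Complex.conj_ofReal, Complex.norm_real,
        Real.norm_of_nonneg (by positivity)]
    · intro j _ hj
      have hj0 : (j : ℕ) ≠ 0 := fun h => hj (Fin.ext h)
      have h1 := hw (Sum.inr ⟨j - 1, by omega⟩)
      rw [U_T_zpow_psi_inr, show ((j : ℕ) - 1 + 1) = j by omega] at h1
      rw [map_smul, inner_smul_left, h1, mul_zero]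
    · simp
  · have h1 := hw (Sum.inl ⟨d, h⟩)
    rw [U_T_zpow_psi_inl] at h1
    rw [hd, h1, norm_zero]
    positivity

lemma eq_zero_of_forall_wavelet {f : S.H} (hf : ∀ q, inner ℂ (S.wavelet q) f = 0) : f = 0 := by
  refine S.eq_zero_of_inner_eq_zero f fun m k => ?_
  have hp := S.sqrt_p_pos
  -- The bound is uniform in `m` and `k`, since each of the `r` steps changes both.
  have key : ∀ (r : ℕ) (m k : ℤ), ‖inner ℂ ((S.U ^ m) ((S.T ^ k) S.phi)) f‖ ≤
      (Real.sqrt S.p)⁻¹ ^ r * ‖f‖ := by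
    intro r
    induction r with
    | zero =>
      intro m k
      refine (norm_inner_le_norm _ _).trans ?_
      rw [LinearIsometryEquiv.norm_map, S.orthonormal_T_zpow_phi.1 k, pow_zero]
    | succ r ih =>
      intro m k
      obtain ⟨k', hk'⟩ := S.norm_inner_le_of_forall_wavelet hf m k
      refine hk'.trans ?_
      rw [pow_succ', mul_assoc]
      gcongr
      exact ih _ _
  have h1 : (Real.sqrt S.p)⁻¹ < 1 := by
    refine inv_lt_one_of_one_lt₀ (Real.lt_sqrt_of_sq_lt ?_)
    have := S.two_le_p
    rw [one_pow]
    exact_mod_cast (by omega : 1 < S.p)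
  have hlim : Filter.Tendsto (fun r : ℕ => (Real.sqrt S.p)⁻¹ ^ r * ‖f‖) Filter.atTop (nhds 0) := by
    simpa using (tendsto_pow_atTop_nhds_zero_of_lt_one (by positivity) h1).mul_const ‖f‖
  exact norm_le_zero_iff.1 (ge_of_tendsto' hlim fun r => key r m k)

/-- The wavelet basis of `L²(R, H^s)`. -/
def waveletBasis : HilbertBasis (ℤ × ℤ × S.WaveletIndex) ℂ S.H :=
  HilbertBasis.mkOfOrthogonalEqBot S.orthonormal_wavelet (by
    rw [Submodule.eq_bot_iff]
    intro f hf
    exact S.eq_zero_of_forall_wavelet fun q =>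
      (Submodule.mem_orthogonal _ _).1 hf _ (Submodule.subset_span ⟨q, rfl⟩))

lemma waveletBasis_apply (q : ℤ × ℤ × S.WaveletIndex) : S.waveletBasis q = S.wavelet q :=
  congrFun (HilbertBasis.coe_mkOfOrthogonalEqBot _ _) q

end AffineIFS

/-! ### The wavelets of the Cantor system -/

namespace AffineIFS

lemma U_symm_T_zpow_phi_ae (S : AffineIFS) (d : ℤ) : S.U.symm ((S.T ^ d) S.phi) =ᵐ[S.mu]
    fun x => (Real.sqrt S.p : ℂ) * S.attractor.indicator (fun _ => 1) (S.N * x - d) := by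
  filter_upwards [S.U_symm_ae ((S.T ^ d) S.phi), S.ae_scale_symm (S.T_zpow_ae d S.phi),
    S.ae_scale_symm (S.ae_T_zpow S.phi_ae d)] with x h1 h2 h3
  rw [h1, h2, h3]

lemma cantor_U_symm_T_zpow_phi_ae (d : ℤ) :
    cantor.U.symm ((cantor.T ^ d) cantor.phi) =ᵐ[cantor.mu]
      fun x => (Real.sqrt 2 : ℂ) * cantorIndicator (3 * x - d) := by
  have h := cantor.U_symm_T_zpow_phi_ae d
  rw [cantor_attractor] at h
  exact h

lemma cantor_psi_inl_ae :
    cantor.psi (Sum.inl ⟨(1 : Fin 3), cantor_gap⟩) =ᵐ[cantor.mu] cantorWavelet 0 := by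
  have e : cantor.psi (Sum.inl ⟨(1 : Fin 3), cantor_gap⟩) =
      cantor.U.symm ((cantor.T ^ (1 : ℤ)) cantor.phi) :=
    congrArg cantor.U.symm (cantor.filterOp_X_pow 1 cantor.phi)
  rw [e]
  filter_upwards [cantor_U_symm_T_zpow_phi_ae 1] with x hx
  rw [hx]
  simp [cantorWavelet]

lemma cantor_psi_inr_ae : cantor.psi (Sum.inr (0 : Fin 1)) =ᵐ[cantor.mu] cantorWavelet 1 := by
  have hs : ((Real.sqrt 2)⁻¹ : ℂ) * (Real.sqrt 2 : ℂ) = 1 :=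
    inv_mul_cancel₀ (by simp)
  have hc0 : cantor.dftCoeff 1 0 = ((Real.sqrt 2)⁻¹ : ℂ) := by
    rw [dftCoeff_comm, dftCoeff_zero, Complex.ofReal_inv]
    rfl
  have hc1 : cantor.dftCoeff 1 1 = -((Real.sqrt 2)⁻¹ : ℂ) := by
    -- For `p = 2` the root of unity is `exp(πi) = -1`, the source of the minus sign in `ψ₂`.
    have h1 : cantor.dftCoeff 1 1 = (((Real.sqrt (2 : ℕ))⁻¹ : ℝ) : ℂ) *
      Complex.exp (2 * Real.pi * Complex.I / (2 : ℕ)) ^ (1 * 1) := rfl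
    rw [h1, Nat.cast_ofNat, Nat.cast_ofNat, mul_assoc,
      mul_div_cancel_left₀ _ (two_ne_zero : (2 : ℂ) ≠ 0), mul_one, pow_one, Complex.exp_pi_mul_I]
    simp
  have e : cantor.psi (Sum.inr (0 : Fin 1)) =
      cantor.dftCoeff 1 0 • cantor.U.symm ((cantor.T ^ (0 : ℤ)) cantor.phi) +
      cantor.dftCoeff 1 1 • cantor.U.symm ((cantor.T ^ (2 : ℤ)) cantor.phi) := by
    have h1 : cantor.filterOp (cantor.dftFilter 1) cantor.phi =
        cantor.dftCoeff 1 0 • (cantor.T ^ (0 : ℤ)) cantor.phi +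
        cantor.dftCoeff 1 1 • (cantor.T ^ (2 : ℤ)) cantor.phi :=
      (cantor.filterOp_dftFilter 1 cantor.phi).trans (Fin.sum_univ_two _)
    have h2 : cantor.psi (Sum.inr (0 : Fin 1)) =
      cantor.U.symm (cantor.filterOp (cantor.dftFilter 1) cantor.phi) := rfl
    rw [h2, h1, map_add, map_smul, map_smul]
  rw [e]
  filter_upwards [cantor_U_symm_T_zpow_phi_ae 0, cantor_U_symm_T_zpow_phi_ae 2,
    Lp.coeFn_add (cantor.dftCoeff 1 0 • cantor.U.symm ((cantor.T ^ (0 : ℤ)) cantor.phi))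
      (cantor.dftCoeff 1 1 • cantor.U.symm ((cantor.T ^ (2 : ℤ)) cantor.phi)),
    Lp.coeFn_smul (cantor.dftCoeff 1 0) (cantor.U.symm ((cantor.T ^ (0 : ℤ)) cantor.phi)),
    Lp.coeFn_smul (cantor.dftCoeff 1 1) (cantor.U.symm ((cantor.T ^ (2 : ℤ)) cantor.phi))]
    with x h0 h2 h3 h4 h5
  rw [h3, Pi.add_apply, h4, h5, Pi.smul_apply, Pi.smul_apply, h0, h2, hc0, hc1, smul_eq_mul,
    smul_eq_mul, neg_mul, ← mul_assoc, ← mul_assoc, hs]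
  simp [cantorWavelet, sub_eq_add_neg]

/-- The labels of the two Cantor wavelets. -/
def cantorLabel : Fin 2 → cantor.WaveletIndex :=
  ![Sum.inl ⟨(1 : Fin 3), cantor_gap⟩, Sum.inr (0 : Fin 1)]

lemma cantor_psi_ae (i : Fin 2) : cantor.psi (cantorLabel i) =ᵐ[cantor.mu] cantorWavelet i := by
  fin_cases i
  · exact cantor_psi_inl_ae
  · exact cantor_psi_inr_ae

lemma cantorLabel_bijective : Function.Bijective cantorLabel := by
  constructor
  · intro i j h
    fin_cases i <;> fin_cases j <;> simp_all [cantorLabel]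
  · rintro (⟨d, hd⟩ | j)
    · change Fin 3 at d
      fin_cases d
      · exact absurd ⟨(0 : Fin 2), rfl⟩ hd
      · exact ⟨0, rfl⟩
      · exact absurd ⟨(1 : Fin 2), rfl⟩ hd
    · change Fin 1 at j
      fin_cases j
      exact ⟨1, rfl⟩

/-- The relabelling `(i, j, k) ↦ (-j, k, i)` of the Cantor wavelets. -/
def cantorEquiv : Fin 2 × ℤ × ℤ ≃ ℤ × ℤ × cantor.WaveletIndex where
  toFun q := (-q.2.1, q.2.2, cantorLabel q.1)
  invFun q := ((Equiv.ofBijective _ cantorLabel_bijective).symm q.2.2, -q.1, q.2.1)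
  left_inv q := by
    obtain ⟨i, j, k⟩ := q
    simp only [neg_neg, Prod.mk.injEq, and_true]
    exact (Equiv.ofBijective _ cantorLabel_bijective).symm_apply_apply i
  right_inv q := by
    obtain ⟨m, n, i⟩ := q
    simp only [neg_neg, Prod.mk.injEq, true_and]
    exact (Equiv.ofBijective _ cantorLabel_bijective).apply_symm_apply i

lemma cantor_mu : cantor.mu =
    (Measure.hausdorffMeasure (Real.logb 3 2)).restrict (inflation 3 cantorSet) := by
  have hR : cantor.R = inflation 3 cantorSet := by
    rw [R, cantor_attractor]
    rfl
  rw [mu, cantor_attractor, cantor_dim, hausdorffMeasure_cantorSet, hR, inv_one, one_smul]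

lemma sqrt_two_zpow (j : ℤ) : Real.sqrt 2 ^ j = (2 : ℝ) ^ ((j : ℝ) / 2) := by
  rw [Real.sqrt_eq_rpow, ← Real.rpow_intCast, ← Real.rpow_mul zero_le_two]
  congr 1
  ring

/-- Since `U` stretches by `3`, the dilation by `3^j` is `U^{-j}`; hence the sign in `cantorEquiv`.
-/
lemma cantor_wavelet_ae (i : Fin 2) (j k : ℤ) :
    cantor.wavelet (cantorEquiv (i, j, k)) =ᵐ[cantor.mu]
      fun x : ℝ => (((2 : ℝ) ^ ((j : ℝ) / 2) : ℝ) : ℂ) *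
        cantorWavelet i ((3 : ℝ) ^ j * x - k) := by
  have hN : ((cantor.N : ℕ) : ℝ) = 3 := by
    change ((3 : ℕ) : ℝ) = 3
    norm_num
  have hp : ((cantor.p : ℕ) : ℝ) = 2 := by
    change ((2 : ℕ) : ℝ) = 2
    norm_num
  have h1 := cantor.U_zpow_T_zpow_ae (-j) k (cantor.psi (cantorLabel i))
  have h2 := cantor.ae_U_zpow (cantor.ae_T_zpow (cantor_psi_ae i) k) j
  rw [neg_neg] at h1
  filter_upwards [h1, h2] with x h1 h2
  rw [hN] at h1 h2
  rw [hp, h2, sqrt_two_zpow] at h1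
  exact h1

/-- The type `Lp ℂ 2 μ` depends on the measure, so the equality of measures is kept as a hypothesis
and eliminated by substitution. -/
lemma exists_cantor_hilbertBasis {μ : Measure ℝ} (hμ : cantor.mu = μ) :
    ∃ b : HilbertBasis (Fin 2 × ℤ × ℤ) ℂ (Lp ℂ 2 μ), ∀ (i : Fin 2) (j k : ℤ),
      b (i, j, k) =ᵐ[μ] fun x : ℝ => (((2 : ℝ) ^ ((j : ℝ) / 2) : ℝ) : ℂ) *
        cantorWavelet i ((3 : ℝ) ^ j * x - k) := by
  subst hμ
  refine ⟨HilbertBasis.mkOfOrthogonalEqBot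
    (cantor.orthonormal_wavelet.comp cantorEquiv cantorEquiv.injective) ?_, fun i j k => ?_⟩
  · rw [Submodule.eq_bot_iff]
    intro f hf
    refine cantor.eq_zero_of_forall_wavelet fun q => ?_
    obtain ⟨q, rfl⟩ := cantorEquiv.surjective q
    exact (Submodule.mem_orthogonal _ _).1 hf _ (Submodule.subset_span ⟨q, rfl⟩)
  · rw [HilbertBasis.coe_mkOfOrthogonalEqBot]
    exact cantor_wavelet_ae i j k

end AffineIFS

end

theorem mainTheorem2 :
    (∀ S : AffineIFS,
      0 < Measure.hausdorffMeasure S.dim S.attractor ∧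
      Measure.hausdorffMeasure S.dim S.attractor < ∞ ∧
      S.U S.phi = S.filterOp S.lowPass S.phi ∧
      ∃ b : HilbertBasis (ℤ × ℤ × S.WaveletIndex) ℂ S.H,
        ∀ (m n : ℤ) (i : S.WaveletIndex), b (m, n, i) = (S.U ^ m) ((S.T ^ n) (S.psi i))) ∧
    (AffineIFS.cantor.attractor = cantorSet ∧
      Measure.hausdorffMeasure (Real.logb 3 2) cantorSet = 1 ∧
      AffineIFS.cantor.psi (Sum.inl ⟨(1 : Fin 3), AffineIFS.cantor_gap⟩)
        =ᵐ[AffineIFS.cantor.mu] cantorWavelet 0 ∧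
      AffineIFS.cantor.psi (Sum.inr (0 : Fin 1)) =ᵐ[AffineIFS.cantor.mu] cantorWavelet 1 ∧
      ∃ b : HilbertBasis (Fin 2 × ℤ × ℤ) ℂ
          (Lp ℂ 2 ((Measure.hausdorffMeasure (Real.logb 3 2)).restrict (inflation 3 cantorSet))),
        ∀ (i : Fin 2) (j k : ℤ),
          b (i, j, k)
            =ᵐ[(Measure.hausdorffMeasure (Real.logb 3 2)).restrict (inflation 3 cantorSet)]
          fun x : ℝ => (((2 : ℝ) ^ ((j : ℝ) / 2) : ℝ) : ℂ) *
            cantorWavelet i ((3 : ℝ) ^ j * x - k)) := by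
  exact ⟨fun S => ⟨S.hausdorffMeasure_attractor_pos, S.hausdorffMeasure_attractor_lt_top, S.U_phi,
    S.waveletBasis, fun m n i => S.waveletBasis_apply (m, n, i)⟩,
    cantor_attractor, hausdorffMeasure_cantorSet, AffineIFS.cantor_psi_inl_ae,
    AffineIFS.cantor_psi_inr_ae, AffineIFS.exists_cantor_hilbertBasis AffineIFS.cantor_mu⟩
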